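/- Let $k$ be a commutative ring and let $H$ be a weak Hopf algebra over $k$ whose antipode $S$ is bijective. Put $\Pi^L(g)=\epsilon(1_{(1)}g)1_{(2)}$ and $R=\mathrm{Im}(\Pi^L)$, a subalgebra of $H$. Then $H$ is an $R$-bialgebroid with source the inclusion $R\subseteq H$, target $t=S^{-1}|_R$, coproduct $h\mapsto h_{(1)}\otimes_R h_{(2)}$ and counit $\Pi^L$, where $r\cdot h\cdot r'=r\,t(r')\,h$. Let $\mathcal{WDK}(H)$ be the category of left-left weak Doi-Koppinen data $(H,A,C)$. Here $A$ is a $k$-algebra and a left $H$-comodule, with coaction $\rho(a)=a_{<-1>}\otimes a_{<0>}$, such that $\rho(ab)=\rho(a)\rho(b)$ and $(H\otimes\rho)\rho(1)=1_{(1)}\otimes 1_{<-1>}1_{(2)}\otimes 1_{<0>}$; and $C$ is a $k$-coalgebra and a left $H$-module such that $\Delta_C(h\cdot c)=h_{(1)}\cdot c_{(1)}\otimes h_{(2)}\cdot c_{(2)}$ and $\epsilon_C(hg\cdot c)=\epsilon(hg_{(2)})\epsilon_C(g_{(1)}\cdot c)$. Morphisms are pairs consisting of an $H$-colinear algebra map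 and an $H$-linear coalgebra map. Let $\mathcal{DK}_R(H)$ be the category of left-left Doi-Koppinen data $(H,A,C)_R$ over $R$. Here $A$ is a left comodule algebra over the $R$-bialgebroid $H$: a $k$-algebra with an algebra map $s_A:R\to A$ and a left coaction $\rho:A\to H\otimes_R A$ of the $R$-coring $H$ whose image lies in $H\times_R A=\{\sum_i h_i\otimes_R a_i : \sum_i h_i t(r)\otimes_R a_i=\sum_i h_i\otimes_R a_i s_A(r)\ \forall r\in R\}$ and which is an algebra map into $H\times_R A$. And $C$ is a left module coalgebra over the $R$-bialgebroid $H$: a left $H$-module and an $R$-coring, with $r\cdot c\cdot r'=r\,t(r')\cdot c$, such that $\Delta_C(h\cdot c)=h_{(1)}\cdot c_{(1)}\otimes_R h_{(2)}\cdot c_{(2)}$ and $\epsilon_C(h\cdot c)=\Pi^L(h\,\epsilon_C(c))$. Morphisms are pairs consisting of an $H$-colinear map of $R$-rings and an $H$-linear map of $R$-corings. Then there is an isomorphism of categories $F:\mathcal{WDK}(H)\to\mathcal{DK}_R(H)$. It leaves the underlying algebra $A$, the underlying left $H$-module $C$ and the underlying maps of morphisms unchanged, and it sends $(H,A,C)$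 to the datum with $s_A(\Pi^L(h))=\epsilon(1_{<-1>}h)1_{<0>}$, coaction $a\mapsto a_{<-1>}\otimes_R a_{<0>}$, coproduct $c\mapsto c_{(1)}\otimes_R c_{(2)}$ and counit $c\mapsto \epsilon_C(1_{(1)}\cdot c)1_{(2)}$. Furthermore, for every weak Doi-Koppinen datum $D=(H,A,C)$, the category of weak Doi-Koppinen modules over $D$ (left $A$-modules $M$ with a left $C$-coaction $\rho_M:M\to C\otimes M$ such that $\rho_M(a\cdot m)=a_{<-1>}\cdot m_{<-1>}\otimes a_{<0>}\cdot m_{<0>}$) is isomorphic to the category of Doi-Koppinen modules over $F(D)$ (left $A$-modules $M$ with a left coaction $\rho_M:M\to C\otimes_R M$ of the $R$-coring $C$ such that $\rho_M(a\cdot m)=a_{<-1>}\cdot m_{<-1>}\otimes_R a_{<0>}\cdot m_{<0>}$); in both categories the morphisms are the $A$-linear $C$-colinear maps. The isomorphism leaves the underlying $A$-modules and maps unchanged and sends $\rho_M$ to its composite with the projection $C\otimes M\to C\otimes_R M$. -/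

import Mathlib

open TensorProduct CategoryTheory

namespace DoiKoppinen

universe uk uR uH uA uC uM

noncomputable section

/-! ## Tensor products over a noncommutative `k`-algebra `R`

All modules are `k`-modules on which `R` acts by `k`-linear endomorphisms; a left (right) `R`-module
structure is a `k`-algebra map from `R` (from `Rᵐᵒᵖ`) to the endomorphism algebra. -/

section Balanced

/-- A left `R`-module structure on the `k`-module `M`. -/
abbrev LeftAct (k : Type*) (R : Type*) (M : Type*) [CommRing k] [Ring R] [Algebra k R]
    [AddCommGroup M] [Module k M] := R →ₐ[k] Module.End k M

/-- A right `R`-module structure on the `k`-module `M`. -/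
abbrev RightAct (k : Type*) (R : Type*) (M : Type*) [CommRing k] [Ring R] [Algebra k R]
    [AddCommGroup M] [Module k M] := Rᵐᵒᵖ →ₐ[k] Module.End k M

/-- An `(R,R)`-bimodule structure on the `k`-module `M`. -/
structure Bimod (k : Type*) (R : Type*) (M : Type*) [CommRing k] [Ring R] [Algebra k R]
    [AddCommGroup M] [Module k M] where
  l : LeftAct k R M
  r : RightAct k R M
  comm : ∀ (a b : R) (m : M), l a (r (.op b) m) = r (.op b) (l a m)

variable {k R : Type*} [CommRing k] [Ring R] [Algebra k R]
variable {M M' N N' P X Y Z : Type*}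
  [AddCommGroup M] [Module k M] [AddCommGroup M'] [Module k M']
  [AddCommGroup N] [Module k N] [AddCommGroup N'] [Module k N']
  [AddCommGroup P] [Module k P]
  [AddCommGroup X] [Module k X] [AddCommGroup Y] [Module k Y] [AddCommGroup Z] [Module k Z]

/-- The relations `m · r ⊗ n = m ⊗ r · n` in `M ⊗[k] N`. -/
def balancedRel (p : RightAct k R M) (q : LeftAct k R N) : Submodule k (M ⊗[k] N) :=
  Submodule.span k {w | ∃ (r : R) (m : M) (n : N), w = p (.op r) m ⊗ₜ n - m ⊗ₜ q r n}

/-- The tensor product `M ⊗_R N` of a right and a left `R`-module. -/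
abbrev BalTensor (p : RightAct k R M) (q : LeftAct k R N) := (M ⊗[k] N) ⧸ balancedRel p q

/-- The canonical projection `M ⊗[k] N → M ⊗_R N`. -/
abbrev can (p : RightAct k R M) (q : LeftAct k R N) : M ⊗[k] N →ₗ[k] BalTensor p q :=
  (balancedRel p q).mkQ

theorem can_bal (p : RightAct k R M) (q : LeftAct k R N) (r : R) (m : M) (n : N) :
    can p q (p (.op r) m ⊗ₜ n) = can p q (m ⊗ₜ q r n) := by
  rw [← sub_eq_zero, ← map_sub, ← LinearMap.mem_ker, Submodule.ker_mkQ]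
  exact Submodule.subset_span ⟨r, m, n, rfl⟩

/-- The universal property of `M ⊗_R N`. -/
def balLift {p : RightAct k R M} {q : LeftAct k R N} (f : M ⊗[k] N →ₗ[k] P)
    (hf : ∀ (r : R) (m : M) (n : N), f (p (.op r) m ⊗ₜ n) = f (m ⊗ₜ q r n)) :
    BalTensor p q →ₗ[k] P :=
  (balancedRel p q).liftQ f <| Submodule.span_le.2 <| by
    rintro _ ⟨r, m, n, rfl⟩
    simp [hf]

@[simp] theorem balLift_can {p : RightAct k R M} {q : LeftAct k R N} (f : M ⊗[k] N →ₗ[k] P)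
    (hf : ∀ (r : R) (m : M) (n : N), f (p (.op r) m ⊗ₜ n) = f (m ⊗ₜ q r n)) (w : M ⊗[k] N) :
    balLift f hf (can p q w) = f w := rfl

/-- `f ⊗_R g` for `f` right `R`-linear and `g` left `R`-linear. -/
def balMap {p : RightAct k R M} {q : LeftAct k R N} {p' : RightAct k R M'} {q' : LeftAct k R N'}
    (f : M →ₗ[k] M') (g : N →ₗ[k] N') (hf : ∀ r m, f (p (.op r) m) = p' (.op r) (f m))
    (hg : ∀ r n, g (q r n) = q' r (g n)) : BalTensor p q →ₗ[k] BalTensor p' q' :=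
  balLift (can p' q' ∘ₗ TensorProduct.map f g) (by
    intro r m n
    simp only [LinearMap.comp_apply, TensorProduct.map_tmul, hf, hg, can_bal])

@[simp] theorem balMap_can {p : RightAct k R M} {q : LeftAct k R N} {p' : RightAct k R M'}
    {q' : LeftAct k R N'} (f : M →ₗ[k] M') (g : N →ₗ[k] N')
    (hf : ∀ r m, f (p (.op r) m) = p' (.op r) (f m)) (hg : ∀ r n, g (q r n) = q' r (g n))
    (w : M ⊗[k] N) :
    balMap (p := p) (q := q) (p' := p') (q' := q') f g hf hg (can p q w) =
      can p' q' (TensorProduct.map f g w) := rfl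

theorem balMap_id {p : RightAct k R M} {q : LeftAct k R N} {f : M →ₗ[k] M} {g : N →ₗ[k] N}
    (hf : ∀ r m, f (p (.op r) m) = p (.op r) (f m)) (hg : ∀ r n, g (q r n) = q r (g n))
    (hf' : f = LinearMap.id) (hg' : g = LinearMap.id) (x : BalTensor p q) :
    balMap f g hf hg x = x := by
  subst hf' hg'
  obtain ⟨w, rfl⟩ := Submodule.mkQ_surjective _ x
  exact congrArg (can p q) (LinearMap.congr_fun TensorProduct.map_id w)

theorem balMap_balMap {M'' N'' : Type*} [AddCommGroup M''] [Module k M''] [AddCommGroup N'']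
    [Module k N''] {p : RightAct k R M} {q : LeftAct k R N} {p' : RightAct k R M'}
    {q' : LeftAct k R N'} {p'' : RightAct k R M''} {q'' : LeftAct k R N''}
    {f : M →ₗ[k] M'} {g : N →ₗ[k] N'} {f' : M' →ₗ[k] M''} {g' : N' →ₗ[k] N''}
    {f'' : M →ₗ[k] M''} {g'' : N →ₗ[k] N''}
    (hf : ∀ r m, f (p (.op r) m) = p' (.op r) (f m)) (hg : ∀ r n, g (q r n) = q' r (g n))
    (hf' : ∀ r m, f' (p' (.op r) m) = p'' (.op r) (f' m)) (hg' : ∀ r n, g' (q' r n) = q'' r (g' n))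
    (hf'' : ∀ r m, f'' (p (.op r) m) = p'' (.op r) (f'' m))
    (hg'' : ∀ r n, g'' (q r n) = q'' r (g'' n)) (h₁ : f' ∘ₗ f = f'') (h₂ : g' ∘ₗ g = g'')
    (x : BalTensor p q) :
    balMap (p' := p'') (q' := q'') f' g' hf' hg' (balMap (p' := p') (q' := q') f g hf hg x) =
      balMap (p' := p'') (q' := q'') f'' g'' hf'' hg'' x := by
  subst h₁ h₂
  obtain ⟨w, rfl⟩ := Submodule.mkQ_surjective _ x
  exact congrArg (can p'' q'') (LinearMap.congr_fun (TensorProduct.map_comp f' g' f g) w).symm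

/-- The left action of `r` on `Y ⊗_R Z`, `r · (y ⊗ z) = r · y ⊗ z`. -/
def balLeftMul (b : Bimod k R Y) (q : LeftAct k R Z) (r : R) :
    BalTensor b.r q →ₗ[k] BalTensor b.r q :=
  balMap (b.l r) LinearMap.id (fun s y => b.comm r s y) (fun _ _ => rfl)

/-- The right action of `r` on `X ⊗_R Y`, `(x ⊗ y) · r = x ⊗ y · r`. -/
def balRightMul (p : RightAct k R X) (b : Bimod k R Y) (r : R) :
    BalTensor p b.l →ₗ[k] BalTensor p b.l :=
  balMap LinearMap.id (b.r (.op r)) (fun _ _ => rfl) (fun s y => (b.comm s r y).symm)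

/-- The relations of `X ⊗_R Y ⊗_R Z` in `X ⊗[k] (Y ⊗[k] Z)`. -/
def balancedRel₃ (p : RightAct k R X) (b : Bimod k R Y) (q : LeftAct k R Z) :
    Submodule k (X ⊗[k] (Y ⊗[k] Z)) :=
  Submodule.span k
    ({w | ∃ (r : R) (x : X) (y : Y) (z : Z),
        w = p (.op r) x ⊗ₜ (y ⊗ₜ z) - x ⊗ₜ (b.l r y ⊗ₜ z)} ∪
     {w | ∃ (r : R) (x : X) (y : Y) (z : Z),
        w = x ⊗ₜ (b.r (.op r) y ⊗ₜ z) - x ⊗ₜ (y ⊗ₜ q r z)})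

/-- The triple tensor product `X ⊗_R Y ⊗_R Z`. -/
abbrev BalTensor₃ (p : RightAct k R X) (b : Bimod k R Y) (q : LeftAct k R Z) :=
  (X ⊗[k] (Y ⊗[k] Z)) ⧸ balancedRel₃ p b q

/-- The canonical projection `X ⊗[k] Y ⊗[k] Z → X ⊗_R Y ⊗_R Z`. -/
abbrev can₃ (p : RightAct k R X) (b : Bimod k R Y) (q : LeftAct k R Z) :
    X ⊗[k] (Y ⊗[k] Z) →ₗ[k] BalTensor₃ p b q := (balancedRel₃ p b q).mkQ

theorem can₃_bal_left (p : RightAct k R X) (b : Bimod k R Y) (q : LeftAct k R Z)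
    (r : R) (x : X) (y : Y) (z : Z) :
    can₃ p b q (p (.op r) x ⊗ₜ (y ⊗ₜ z)) = can₃ p b q (x ⊗ₜ (b.l r y ⊗ₜ z)) := by
  rw [← sub_eq_zero, ← map_sub, ← LinearMap.mem_ker, Submodule.ker_mkQ]
  exact Submodule.subset_span (Or.inl ⟨r, x, y, z, rfl⟩)

theorem can₃_bal_right (p : RightAct k R X) (b : Bimod k R Y) (q : LeftAct k R Z)
    (r : R) (x : X) (y : Y) (z : Z) :
    can₃ p b q (x ⊗ₜ (b.r (.op r) y ⊗ₜ z)) = can₃ p b q (x ⊗ₜ (y ⊗ₜ q r z)) := by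
  rw [← sub_eq_zero, ← map_sub, ← LinearMap.mem_ker, Submodule.ker_mkQ]
  exact Submodule.subset_span (Or.inr ⟨r, x, y, z, rfl⟩)

/-- `x ⊗ [y ⊗ z] ↦ [x ⊗ y ⊗ z]`, as a `k`-bilinear map `X → Y ⊗_R Z → X ⊗_R Y ⊗_R Z`. -/
def consLeft (p : RightAct k R X) (b : Bimod k R Y) (q : LeftAct k R Z) :
    X →ₗ[k] BalTensor b.r q →ₗ[k] BalTensor₃ p b q :=
  LinearMap.flip <| balLift
    ((TensorProduct.mk k X (Y ⊗[k] Z)).flip.compr₂ (can₃ p b q)) (by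
      intro r y z
      ext x
      exact can₃_bal_right p b q r x y z)

@[simp] theorem consLeft_can (p : RightAct k R X) (b : Bimod k R Y) (q : LeftAct k R Z) (x : X)
    (w : Y ⊗[k] Z) : consLeft p b q x (can b.r q w) = can₃ p b q (x ⊗ₜ w) := rfl

/-- `[x ⊗ y] ⊗ z ↦ [x ⊗ y ⊗ z]`, as a `k`-bilinear map `X ⊗_R Y → Z → X ⊗_R Y ⊗_R Z`. -/
def consRight (p : RightAct k R X) (b : Bimod k R Y) (q : LeftAct k R Z) :
    BalTensor p b.l →ₗ[k] Z →ₗ[k] BalTensor₃ p b q :=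
  balLift
    ((TensorProduct.mk k (X ⊗[k] Y) Z).compr₂
      (can₃ p b q ∘ₗ (TensorProduct.assoc k X Y Z).toLinearMap)) (by
      intro r x y
      ext z
      exact can₃_bal_left p b q r x y z)

@[simp] theorem consRight_can (p : RightAct k R X) (b : Bimod k R Y) (q : LeftAct k R Z)
    (w : X ⊗[k] Y) (z : Z) :
    consRight p b q (can p b.l w) z = can₃ p b q (TensorProduct.assoc k X Y Z (w ⊗ₜ z)) := rfl

/-- `X ⊗_R f : X ⊗_R N → X ⊗_R Y ⊗_R Z` for a left `R`-linear map `f : N → Y ⊗_R Z`. -/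
def whiskerL (p : RightAct k R X) {b : Bimod k R Y} {q : LeftAct k R Z} {qN : LeftAct k R N}
    (f : N →ₗ[k] BalTensor b.r q) (hf : ∀ r n, f (qN r n) = balLeftMul b q r (f n)) :
    BalTensor p qN →ₗ[k] BalTensor₃ p b q :=
  balLift (TensorProduct.lift ((consLeft p b q).compl₂ f)) (by
    intro r x n
    simp only [TensorProduct.lift.tmul, LinearMap.compl₂_apply, hf]
    obtain ⟨w, hw⟩ := Submodule.mkQ_surjective _ (f n)
    rw [← hw, balLeftMul, balMap_can, consLeft_can, consLeft_can]
    induction w using TensorProduct.induction_on generalizing n with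
    | zero => simp
    | tmul y z => exact can₃_bal_left p b q r x y z
    | add w₁ w₂ h₁ h₂ =>
      have key : ∀ w : Y ⊗[k] Z, can₃ p b q (p (.op r) x ⊗ₜ w) =
          can₃ p b q (x ⊗ₜ TensorProduct.map (b.l r) LinearMap.id w) := by
        intro w
        induction w using TensorProduct.induction_on with
        | zero => simp
        | tmul y z => exact can₃_bal_left p b q r x y z
        | add w₁ w₂ h₁ h₂ => rw [map_add, tmul_add, tmul_add, map_add, map_add, h₁, h₂]
      exact key _)

/-- `f ⊗_R Z : N ⊗_R Z → X ⊗_R Y ⊗_R Z` for a right `R`-linear map `f : N → X ⊗_R Y`. -/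
def whiskerR {p : RightAct k R X} {b : Bimod k R Y} (q : LeftAct k R Z) {pN : RightAct k R N}
    (f : N →ₗ[k] BalTensor p b.l) (hf : ∀ r n, f (pN (.op r) n) = balRightMul p b r (f n)) :
    BalTensor pN q →ₗ[k] BalTensor₃ p b q :=
  balLift (TensorProduct.lift (consRight p b q ∘ₗ f)) (by
    intro r n z
    simp only [TensorProduct.lift.tmul, LinearMap.comp_apply, hf]
    obtain ⟨w, hw⟩ := Submodule.mkQ_surjective _ (f n)
    rw [← hw, balRightMul, balMap_can, consRight_can, consRight_can]
    have key : ∀ w : X ⊗[k] Y,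
        can₃ p b q (TensorProduct.assoc k X Y Z
          (TensorProduct.map LinearMap.id (b.r (.op r)) w ⊗ₜ z)) =
        can₃ p b q (TensorProduct.assoc k X Y Z (w ⊗ₜ q r z)) := by
      intro w
      induction w using TensorProduct.induction_on with
      | zero => simp
      | tmul x y => exact can₃_bal_right p b q r x y z
      | add w₁ w₂ h₁ h₂ =>
        rw [map_add, add_tmul, add_tmul, map_add, map_add, map_add, map_add, h₁, h₂]
    exact key w)

end Balanced

/-! ## Corings and their comodules -/

section Coring

variable {k R : Type*} [CommRing k] [Ring R] [Algebra k R]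
variable {C : Type*} [AddCommGroup C] [Module k C] {M : Type*} [AddCommGroup M] [Module k M]

/-- `c ⊗_R m ↦ e(c) · m` for a right `R`-linear map `e : C → R`. -/
def counitL {p : RightAct k R C} (e : C →ₗ[k] R) (he : ∀ r c, e (p (.op r) c) = e c * r)
    (q : LeftAct k R M) : BalTensor p q →ₗ[k] M :=
  balLift (TensorProduct.lift (q.toLinearMap ∘ₗ e)) (by intro r c m; simp [he])

/-- `m ⊗_R c ↦ m · e(c)` for a left `R`-linear map `e : C → R`. -/
def counitR {q : LeftAct k R C} (e : C →ₗ[k] R) (he : ∀ r c, e (q r c) = r * e c)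
    (p : RightAct k R M) : BalTensor p q →ₗ[k] M :=
  balLift (TensorProduct.lift
    (p.toLinearMap ∘ₗ (MulOpposite.opLinearEquiv k).toLinearMap ∘ₗ e).flip) (by
      intro r m c; simp [he])

/-- An `R`-coring structure on an `(R,R)`-bimodule `C`. -/
structure Coring (b : Bimod k R C) where
  comul : C →ₗ[k] BalTensor b.r b.l
  counit : C →ₗ[k] R
  comul_left : ∀ r c, comul (b.l r c) = balLeftMul b b.l r (comul c)
  comul_right : ∀ r c, comul (b.r (.op r) c) = balRightMul b.r b r (comul c)
  counit_left : ∀ r c, counit (b.l r c) = r * counit c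
  counit_right : ∀ r c, counit (b.r (.op r) c) = counit c * r
  coassoc : ∀ c, whiskerR b.l comul comul_right (comul c) = whiskerL b.r comul comul_left (comul c)
  counit_comul : ∀ c, counitL counit counit_right b.l (comul c) = c
  comul_counit : ∀ c, counitR counit counit_left b.r (comul c) = c

/-- A left comodule structure over the `R`-coring `D` on a left `R`-module `M`. -/
structure LeftComodule {b : Bimod k R C} (D : Coring b) (q : LeftAct k R M) where
  coact : M →ₗ[k] BalTensor b.r q
  coact_left : ∀ r m, coact (q r m) = balLeftMul b q r (coact m)
  coassoc : ∀ m, whiskerL b.r coact coact_left (coact m) = whiskerR q D.comul D.comul_right (coact m)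
  counit_coact : ∀ m, counitL D.counit D.counit_right q (coact m) = m

end Coring

/-! ## Bialgebroids -/

section Bialgebroid

/-- An `R^e`-ring, given by its source and target maps. -/
structure EnvRing (k : Type*) (R : Type*) (H : Type*) [CommRing k] [Ring R] [Algebra k R]
    [Ring H] [Algebra k H] where
  src : R →ₐ[k] H
  tgt : Rᵐᵒᵖ →ₐ[k] H
  src_tgt_comm : ∀ a b, src a * tgt b = tgt b * src a

variable {k R H : Type*} [CommRing k] [Ring R] [Algebra k R] [Ring H] [Algebra k H]
variable {A : Type*} [Ring A] [Algebra k A]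

/-- The left `R`-module structure on an `A`-module along an algebra map `R → A`. -/
abbrev leftAct (s : R →ₐ[k] A) (M : Type*) [AddCommGroup M] [Module k M] [Module A M]
    [IsScalarTower k A M] : LeftAct k R M :=
  (Algebra.lsmul k k M).comp s

/-- The `R`-bimodule structure `r · c · r' = s(r) t(r') · c` on a left `H`-module. For `C = H` this
is the bimodule structure of `H` itself. -/
abbrev EnvRing.bimod (E : EnvRing k R H) (C : Type*) [AddCommGroup C] [Module k C] [Module H C]
    [IsScalarTower k H C] : Bimod k R C where
  l := leftAct E.src C
  r := (Algebra.lsmul k k C).comp E.tgt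
  comm := by
    intro a b m
    simp only [AlgHom.comp_apply, Algebra.lsmul_coe, smul_smul, E.src_tgt_comm]

/-- The subset `H ×_R A` of `H ⊗_R A`: all `∑ hᵢ ⊗ aᵢ` with `∑ hᵢ t(r) ⊗ aᵢ = ∑ hᵢ ⊗ aᵢ s(r)`. -/
def takeuchi (E : EnvRing k R H) (s : R →ₐ[k] A) :
    Set (BalTensor (E.bimod H).r (leftAct s A)) :=
  {x | ∀ r : R,
    balMap (p' := (E.bimod H).r) (q' := leftAct s A) (LinearMap.mulRight k (E.tgt (.op r)))
      LinearMap.id (by intro r' h; simp [mul_assoc]) (fun _ _ => rfl) x =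
    balMap (p' := (E.bimod H).r) (q' := leftAct s A) LinearMap.id (LinearMap.mulRight k (s r))
      (fun _ _ => rfl) (by intro r' a; simp [mul_assoc]) x}

variable {C : Type*} [AddCommGroup C] [Module k C] [Module H C] [IsScalarTower k H C]
variable {M : Type*} [AddCommGroup M] [Module k M] [Module A M] [IsScalarTower k A M]

variable (k H A C M) in
/-- The componentwise action `(h ⊗ a) · (c ⊗ m) = h · c ⊗ a · m` of `H ⊗[k] A` on `C ⊗[k] M`. -/
def tensorAct : H ⊗[k] A →ₗ[k] C ⊗[k] M →ₗ[k] C ⊗[k] M :=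
  TensorProduct.map₂ (Algebra.lsmul k k C : H →ₐ[k] Module.End k C).toLinearMap
    (Algebra.lsmul k k M : A →ₐ[k] Module.End k M).toLinearMap

@[simp] theorem tensorAct_tmul (h : H) (a : A) (c : C) (m : M) :
    tensorAct k H A C M (h ⊗ₜ a) (c ⊗ₜ m) = (h • c) ⊗ₜ (a • m) := rfl

variable (C M) in
/-- `[h ⊗ a] ↦ (c ⊗ m ↦ [h · c ⊗ a · m])`. -/
def preAct (E : EnvRing k R H) (s : R →ₐ[k] A) :
    BalTensor (E.bimod H).r (leftAct s A) →ₗ[k]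
      C ⊗[k] M →ₗ[k] BalTensor (E.bimod C).r (leftAct s M) :=
  balLift ((tensorAct k H A C M).compr₂ (can (E.bimod C).r (leftAct s M))) (by
    intro r h a
    ext c m
    have := can_bal (E.bimod C).r (leftAct s M) r (h • c) (a • m)
    simpa [smul_smul] using this)

@[simp] theorem preAct_can (E : EnvRing k R H) (s : R →ₐ[k] A) (w : H ⊗[k] A) (v : C ⊗[k] M) :
    preAct C M E s (can _ _ w) v = can _ _ (tensorAct k H A C M w v) := rfl

/-- The componentwise action of an element of `H ×_R A` on `C ⊗_R M`, for a left `H`-module `C` and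
a left `A`-module `M`: `(∑ hᵢ ⊗ aᵢ) · (c ⊗ m) = ∑ hᵢ · c ⊗ aᵢ · m`. For `C = H`, `M = A` this is the
product of `H ×_R A`. -/
def takAct (E : EnvRing k R H) (s : R →ₐ[k] A) (x : takeuchi E s) :
    BalTensor (E.bimod C).r (leftAct s M) →ₗ[k] BalTensor (E.bimod C).r (leftAct s M) :=
  balLift (preAct C M E s x.1) (by
    intro r c m
    obtain ⟨x, hx⟩ := x
    obtain ⟨w, rfl⟩ := Submodule.mkQ_surjective _ x
    have hr : can (E.bimod C).r (leftAct s M) (tensorAct k H A C M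
          (TensorProduct.map (LinearMap.mulRight k (E.tgt (.op r))) LinearMap.id w) (c ⊗ₜ m)) =
        can (E.bimod C).r (leftAct s M) (tensorAct k H A C M
          (TensorProduct.map LinearMap.id (LinearMap.mulRight k (s r)) w) (c ⊗ₜ m)) :=
      congrArg (fun y => preAct C M E s y (c ⊗ₜ m)) (hx r)
    have h1 : ∀ w, tensorAct k H A C M
        (TensorProduct.map (LinearMap.mulRight k (E.tgt (.op r))) LinearMap.id w) (c ⊗ₜ m) =
        tensorAct k H A C M w ((E.bimod C).r (.op r) c ⊗ₜ m) := by
      intro w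
      induction w using TensorProduct.induction_on with
      | zero => simp
      | tmul h a => simp [mul_smul]
      | add w₁ w₂ h₁ h₂ => simp only [map_add, LinearMap.add_apply, h₁, h₂]
    have h2 : ∀ w, tensorAct k H A C M
        (TensorProduct.map LinearMap.id (LinearMap.mulRight k (s r)) w) (c ⊗ₜ m) =
        tensorAct k H A C M w (c ⊗ₜ leftAct s M r m) := by
      intro w
      induction w using TensorProduct.induction_on with
      | zero => simp
      | tmul h a => simp [mul_smul]
      | add w₁ w₂ h₁ h₂ => simp only [map_add, LinearMap.add_apply, h₁, h₂]
    rw [h1, h2] at hr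
    exact hr)

theorem takAct_can (E : EnvRing k R H) (s : R →ₐ[k] A) (w : H ⊗[k] A)
    (hw : can _ _ w ∈ takeuchi E s) (v : C ⊗[k] M) :
    takAct E s ⟨can _ _ w, hw⟩ (can _ _ v) =
      can (E.bimod C).r (leftAct s M) (tensorAct k H A C M w v) := rfl

variable (k R H) in
/-- An `R`-bialgebroid structure on the `k`-algebra `H`. -/
structure Bialgebroid extends EnvRing k R H where
  coring : Coring (toEnvRing.bimod H)
  comul_mem : ∀ h, coring.comul h ∈ takeuchi toEnvRing src
  comul_one : coring.comul 1 = can _ _ (1 ⊗ₜ 1)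
  comul_mul : ∀ g h,
    coring.comul (g * h) = takAct toEnvRing src ⟨coring.comul g, comul_mem g⟩ (coring.comul h)
  counit_one : coring.counit 1 = 1
  counit_mul_src : ∀ g h, coring.counit (g * h) = coring.counit (g * src (coring.counit h))
  counit_mul_tgt : ∀ g h, coring.counit (g * h) = coring.counit (g * tgt (.op (coring.counit h)))

variable (B : Bialgebroid k R H)

/-- A left `H`-comodule algebra structure on `A`, for an `R`-bialgebroid `H`. -/
structure ComoduleAlgebra (A : Type*) [Ring A] [Algebra k A] where
  src : R →ₐ[k] A
  comod : LeftComodule B.coring (leftAct src A)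
  coact_mem : ∀ a, comod.coact a ∈ takeuchi B.toEnvRing src
  coact_one : comod.coact 1 = can _ _ (1 ⊗ₜ 1)
  coact_mul : ∀ a b,
    comod.coact (a * b) = takAct B.toEnvRing src ⟨comod.coact a, coact_mem a⟩ (comod.coact b)

/-- A left `H`-module coalgebra structure on the left `H`-module `C`, for an `R`-bialgebroid `H`. -/
structure ModuleCoalgebra (C : Type*) [AddCommGroup C] [Module k C] [Module H C]
    [IsScalarTower k H C] where
  coring : Coring (B.bimod C)
  comul_smul : ∀ (h : H) (c : C), coring.comul (h • c) =
    takAct B.toEnvRing B.src ⟨B.coring.comul h, B.comul_mem h⟩ (coring.comul c)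
  counit_smul : ∀ (h : H) (c : C),
    coring.counit (h • c) = B.coring.counit (h * B.src (coring.counit c))

variable {B}

/-- A left-left Doi-Koppinen module structure over `R` on the left `A`-module `M`. -/
structure DKModule (a : ComoduleAlgebra B A) (c : ModuleCoalgebra B C) (M : Type*)
    [AddCommGroup M] [Module k M] [Module A M] [IsScalarTower k A M] where
  comod : LeftComodule c.coring (leftAct a.src M)
  coact_smul : ∀ (x : A) (m : M), comod.coact (x • m) =
    takAct B.toEnvRing a.src ⟨a.comod.coact x, a.coact_mem x⟩ (comod.coact m)

end Bialgebroid

/-! ## Weak Hopf algebras -/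

section Weak

open Coalgebra

/-- Weak bialgebras over `k`. -/
class WeakBialgebra (k : Type*) (H : Type*) [CommRing k] [Ring H] [Algebra k H]
    extends Coalgebra k H where
  comul_mul : ∀ x y : H, comul (x * y) = comul x * comul y
  /-- `ε(x y z) = ε(x y₍₁₎) ε(y₍₂₎ z)` -/
  counit_mul_mul : ∀ x y z : H, counit (x * y * z) =
    LinearMap.mul' k k (TensorProduct.map (counit ∘ₗ LinearMap.mulLeft k x)
      (counit ∘ₗ LinearMap.mulRight k z) (comul y))
  /-- `ε(x y z) = ε(x y₍₂₎) ε(y₍₁₎ z)` -/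
  counit_mul_mul' : ∀ x y z : H, counit (x * y * z) =
    LinearMap.mul' k k (TensorProduct.map (counit ∘ₗ LinearMap.mulRight k z)
      (counit ∘ₗ LinearMap.mulLeft k x) (comul y))
  /-- `(Δ ⊗ H)Δ(1) = (Δ(1) ⊗ 1)(1 ⊗ Δ(1))` -/
  comul_comul_one :
    TensorProduct.assoc k H H H (comul.rTensor H (comul (1 : H))) =
      TensorProduct.assoc k H H H (comul (1 : H) ⊗ₜ[k] (1 : H)) *
        ((1 : H) ⊗ₜ[k] comul (1 : H))
  /-- `(Δ ⊗ H)Δ(1) = (1 ⊗ Δ(1))(Δ(1) ⊗ 1)` -/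
  comul_comul_one' :
    TensorProduct.assoc k H H H (comul.rTensor H (comul (1 : H))) =
      ((1 : H) ⊗ₜ[k] comul (1 : H)) *
        TensorProduct.assoc k H H H (comul (1 : H) ⊗ₜ[k] (1 : H))

variable (k : Type*) {H : Type*} [CommRing k] [Ring H] [Algebra k H]

/-- `Π^L(g) = ε(1₍₁₎ g) 1₍₂₎`. -/
def piL [WeakBialgebra k H] (g : H) : H :=
  TensorProduct.lid k H
    ((counit (R := k) ∘ₗ LinearMap.mulRight k g).rTensor H (comul (R := k) (1 : H)))

/-- `Π^R(g) = 1₍₁₎ ε(g 1₍₂₎)`. -/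
def piR [WeakBialgebra k H] (g : H) : H :=
  TensorProduct.rid k H
    ((counit (R := k) ∘ₗ LinearMap.mulLeft k g).lTensor H (comul (R := k) (1 : H)))

theorem comul_piL [WeakBialgebra k H] (g : H) :
    comul (R := k) (piL k g) = comul (R := k) (1 : H) * (piL k g ⊗ₜ 1) := by
  unfold piL
  set φ : H →ₗ[k] k := counit (R := k) ∘ₗ LinearMap.mulRight k g
  have h1 : ∀ x : H ⊗[k] H, comul (R := k) (TensorProduct.lid k H (φ.rTensor H x)) =
      TensorProduct.lid k (H ⊗[k] H) (φ.rTensor (H ⊗[k] H) (comul.lTensor H x)) := by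
    intro x
    induction x using TensorProduct.induction_on with
    | zero => simp
    | tmul a b => simp
    | add a b ha hb => simp only [map_add, ha, hb]
  have h2 : ∀ (u : H ⊗[k] H) (w : H ⊗[k] (H ⊗[k] H)),
      TensorProduct.lid k (H ⊗[k] H) (φ.rTensor (H ⊗[k] H) ((1 : H) ⊗ₜ[k] u * w)) =
        u * TensorProduct.lid k (H ⊗[k] H) (φ.rTensor (H ⊗[k] H) w) := by
    intro u w
    induction w using TensorProduct.induction_on with
    | zero => simp
    | tmul a b => simp
    | add a b ha hb => simp only [map_add, mul_add, ha, hb]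
  have h3 : ∀ x : H ⊗[k] H, TensorProduct.lid k (H ⊗[k] H) (φ.rTensor (H ⊗[k] H)
      (TensorProduct.assoc k H H H (x ⊗ₜ[k] (1 : H)))) =
        TensorProduct.lid k H (φ.rTensor H x) ⊗ₜ 1 := by
    intro x
    induction x using TensorProduct.induction_on with
    | zero => simp
    | tmul a b => simp [TensorProduct.smul_tmul']
    | add a b ha hb => simp only [map_add, add_tmul, ha, hb]
  rw [h1, ← coassoc_apply, WeakBialgebra.comul_comul_one', h2, h3]

theorem mem_range_piL [WeakBialgebra k H] (z : H) : z ∈ Set.range (piL (H := H) k) ↔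
    comul (R := k) z = comul (R := k) (1 : H) * (z ⊗ₜ 1) := by
  constructor
  · rintro ⟨g, rfl⟩
    exact comul_piL k g
  · intro hz
    refine ⟨z, ?_⟩
    have h : ∀ x : H ⊗[k] H,
        (counit (R := k) ∘ₗ LinearMap.mulRight k z).rTensor H x =
          (counit (R := k)).rTensor H (x * (z ⊗ₜ 1)) := by
      intro x
      induction x using TensorProduct.induction_on with
      | zero => simp
      | tmul a b => simp
      | add a b ha hb => simp only [map_add, add_mul, ha, hb]
    rw [piL, h, ← hz, rTensor_counit_comul, TensorProduct.lid_tmul, one_smul]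

variable (H) in
/-- The subalgebra `R = Im Π^L` of `H`. -/
def leftBase [WeakBialgebra k H] : Subalgebra k H where
  carrier := Set.range (piL (H := H) k)
  mul_mem' := by
    intro z w hz hw
    rw [mem_range_piL] at *
    have h1 : comul (R := k) z * comul (R := k) (1 : H) = comul (R := k) z := by
      rw [← WeakBialgebra.comul_mul, mul_one]
    rw [WeakBialgebra.comul_mul, hw, ← mul_assoc, h1, hz, mul_assoc]
    simp
  add_mem' := by
    intro z w hz hw
    rw [mem_range_piL] at *
    rw [map_add, hz, hw, add_tmul, mul_add]
  algebraMap_mem' := by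
    intro c
    rw [mem_range_piL, Algebra.algebraMap_eq_smul_one, map_smul, ← TensorProduct.smul_tmul',
      mul_smul_comm, ← Algebra.TensorProduct.one_def, mul_one]

/-- Weak Hopf algebras over `k`. -/
class WeakHopfAlgebra (k : Type*) (H : Type*) [CommRing k] [Ring H] [Algebra k H]
    extends WeakBialgebra k H where
  antipode : H →ₗ[k] H
  mul_antipode : ∀ h : H,
    LinearMap.mul' k H (TensorProduct.map LinearMap.id antipode (comul h)) = piL k h
  antipode_mul : ∀ h : H,
    LinearMap.mul' k H (TensorProduct.map antipode LinearMap.id (comul h)) = piR k h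
  /-- `S(h₍₁₎) h₍₂₎ S(h₍₃₎) = S(h)` -/
  antipode_mul_antipode : ∀ h : H,
    LinearMap.mul' k H (TensorProduct.map antipode
      (LinearMap.mul' k H ∘ₗ TensorProduct.map LinearMap.id antipode)
      (comul.lTensor H (comul h))) = antipode h

variable (H) [WeakBialgebra k H]

/-- A left weak `H`-comodule algebra structure on the `k`-algebra `A`. -/
structure WeakComoduleAlgebra (A : Type*) [Ring A] [Algebra k A] where
  coact : A →ₗ[k] H ⊗[k] A
  coassoc : ∀ a, coact.lTensor H (coact a) =
    TensorProduct.assoc k H H A (comul.rTensor A (coact a))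
  counit_coact : ∀ a, TensorProduct.lid k A (counit.rTensor A (coact a)) = a
  coact_mul : ∀ a b, coact (a * b) = coact a * coact b
  /-- `(H ⊗ ρ)ρ(1) = 1₍₁₎ ⊗ 1₍₋₁₎ 1₍₂₎ ⊗ 1₍₀₎` -/
  coact_one : coact.lTensor H (coact 1) =
    ((1 : H) ⊗ₜ[k] coact 1) *
      TensorProduct.assoc k H H A (comul (R := k) (1 : H) ⊗ₜ[k] (1 : A))

/-- A left weak `H`-module coalgebra structure on the left `H`-module `C`. -/
structure WeakModuleCoalgebra (C : Type*) [AddCommGroup C] [Module k C] [Module H C]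
    [IsScalarTower k H C] where
  coalg : Coalgebra k C
  comul_smul : ∀ (h : H) (c : C), coalg.comul (h • c) =
    tensorAct k H H C C (comul (R := k) h) (coalg.comul c)
  /-- `ε(h g · c) = ε(h g₍₂₎) ε(g₍₁₎ · c)` -/
  counit_smul : ∀ (h g : H) (c : C), coalg.counit ((h * g) • c) =
    LinearMap.mul' k k (TensorProduct.map
      (coalg.counit ∘ₗ ((Algebra.lsmul k k C : H →ₐ[k] Module.End k C).toLinearMap.flip c))
      (counit ∘ₗ LinearMap.mulLeft k h) (comul (R := k) g))

variable {k H}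
variable {A : Type*} [Ring A] [Algebra k A]
variable {C : Type*} [AddCommGroup C] [Module k C] [Module H C] [IsScalarTower k H C]

/-- A left-left weak Doi-Koppinen module structure on the left `A`-module `M`. -/
structure WeakDKModule (a : WeakComoduleAlgebra k H A) (c : WeakModuleCoalgebra k H C) (M : Type*)
    [AddCommGroup M] [Module k M] [Module A M] [IsScalarTower k A M] where
  coact : M →ₗ[k] C ⊗[k] M
  coassoc : ∀ m, coact.lTensor C (coact m) =
    TensorProduct.assoc k C C M (c.coalg.comul.rTensor M (coact m))
  counit_coact : ∀ m, TensorProduct.lid k M (c.coalg.counit.rTensor M (coact m)) = m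
  coact_smul : ∀ (x : A) (m : M),
    coact (x • m) = tensorAct k H A C M (a.coact x) (coact m)

end Weak

/-! ## The categories -/

section Categories

variable (k : Type uk) [CommRing k] (H : Type uH) [Ring H] [Algebra k H]

section WeakCategories

variable [WeakBialgebra k H]

/-- Left weak `H`-comodule algebras. -/
structure WeakComoduleAlgebraCat where
  carrier : Type uA
  [ring : Ring carrier]
  [algebra : Algebra k carrier]
  str : WeakComoduleAlgebra k H carrier

attribute [instance] WeakComoduleAlgebraCat.ring WeakComoduleAlgebraCat.algebra

/-- Left weak `H`-module coalgebras. -/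
structure WeakModuleCoalgebraCat where
  carrier : Type uC
  [group : AddCommGroup carrier]
  [modk : Module k carrier]
  [modH : Module H carrier]
  [tower : IsScalarTower k H carrier]
  str : WeakModuleCoalgebra k H carrier

attribute [instance] WeakModuleCoalgebraCat.group WeakModuleCoalgebraCat.modk
  WeakModuleCoalgebraCat.modH WeakModuleCoalgebraCat.tower

variable {k H}

/-- `H`-colinear algebra maps. -/
@[ext] structure WeakComoduleAlgebraCat.Hom (X Y : WeakComoduleAlgebraCat.{uk, uH, uA} k H) where
  hom : X.carrier →ₐ[k] Y.carrier
  colinear : ∀ x, Y.str.coact (hom x) = hom.toLinearMap.lTensor H (X.str.coact x)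

instance : Category (WeakComoduleAlgebraCat.{uk, uH, uA} k H) where
  Hom X Y := WeakComoduleAlgebraCat.Hom X Y
  id X := ⟨AlgHom.id k _, by intro x; simp⟩
  comp f g := ⟨g.hom.comp f.hom, by
    intro x
    rw [AlgHom.comp_apply, g.colinear, f.colinear, ← LinearMap.comp_apply,
      ← LinearMap.lTensor_comp]
    rfl⟩

/-- `H`-linear coalgebra maps. -/
@[ext] structure WeakModuleCoalgebraCat.Hom (X Y : WeakModuleCoalgebraCat.{uk, uH, uC} k H) where
  hom : X.carrier →ₗ[H] Y.carrier
  map_comul : ∀ x, Y.str.coalg.comul (hom x) =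
    TensorProduct.map (hom.restrictScalars k) (hom.restrictScalars k) (X.str.coalg.comul x)
  map_counit : ∀ x, Y.str.coalg.counit (hom x) = X.str.coalg.counit x

instance : Category (WeakModuleCoalgebraCat.{uk, uH, uC} k H) where
  Hom X Y := WeakModuleCoalgebraCat.Hom X Y
  id X := ⟨LinearMap.id, by intro x; simp, by intro x; rfl⟩
  comp f g := ⟨g.hom.comp f.hom, by
    intro x
    rw [LinearMap.comp_apply, g.map_comul, f.map_comul, ← LinearMap.comp_apply,
      ← TensorProduct.map_comp]
    rfl, by
    intro x
    rw [LinearMap.comp_apply, g.map_counit, f.map_counit]⟩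

variable (k H) in
/-- The category of left-left weak Doi-Koppinen data `(H, A, C)` over `H`. -/
abbrev WeakDKDatum := WeakComoduleAlgebraCat.{uk, uH, uA} k H × WeakModuleCoalgebraCat.{uk, uH, uC} k H

variable (k H) in
/-- `(H, A, C) ↦ (A, C)`, where `A` is regarded as an algebra and `C` as a left `H`-module. -/
def weakForget : WeakDKDatum.{uk, uH, uA, uC} k H ⥤ AlgCat.{uA} k × ModuleCat.{uC} H where
  obj D := (AlgCat.of k D.1.carrier, ModuleCat.of H D.2.carrier)
  map f := (AlgCat.ofHom f.1.hom, ModuleCat.ofHom f.2.hom)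

/-- Left-left weak Doi-Koppinen modules associated to a weak Doi-Koppinen datum. -/
structure WeakDKModuleCat (D : WeakDKDatum.{uk, uH, uA, uC} k H) where
  carrier : Type uM
  [group : AddCommGroup carrier]
  [modk : Module k carrier]
  [modA : Module D.1.carrier carrier]
  [tower : IsScalarTower k D.1.carrier carrier]
  str : WeakDKModule D.1.str D.2.str carrier

attribute [instance] WeakDKModuleCat.group WeakDKModuleCat.modk WeakDKModuleCat.modA
  WeakDKModuleCat.tower

variable {D : WeakDKDatum.{uk, uH, uA, uC} k H}

/-- `A`-linear and `C`-colinear maps. -/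
@[ext] structure WeakDKModuleCat.Hom (X Y : WeakDKModuleCat.{uk, uH, uA, uC, uM} D) where
  hom : X.carrier →ₗ[D.1.carrier] Y.carrier
  colinear : ∀ x, Y.str.coact (hom x) =
    (hom.restrictScalars k).lTensor D.2.carrier (X.str.coact x)

instance : Category (WeakDKModuleCat.{uk, uH, uA, uC, uM} D) where
  Hom X Y := WeakDKModuleCat.Hom X Y
  id X := ⟨LinearMap.id, by intro x; simp⟩
  comp f g := ⟨g.hom.comp f.hom, by
    intro x
    rw [LinearMap.comp_apply, g.colinear, f.colinear, ← LinearMap.comp_apply,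
      ← LinearMap.lTensor_comp]
    rfl⟩

variable (D) in
/-- The underlying left `A`-module of a weak Doi-Koppinen module. -/
def weakModuleForget : WeakDKModuleCat.{uk, uH, uA, uC, uM} D ⥤ ModuleCat.{uM} D.1.carrier where
  obj M := ModuleCat.of D.1.carrier M.carrier
  map f := ModuleCat.ofHom f.hom

end WeakCategories

section BialgebroidCategories

variable {k H} {R : Type uR} [Ring R] [Algebra k R] (B : Bialgebroid k R H)

/-- Left comodule algebras over the `R`-bialgebroid `H`. -/
structure ComoduleAlgebraCat where
  carrier : Type uA
  [ring : Ring carrier]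
  [algebra : Algebra k carrier]
  str : ComoduleAlgebra B carrier

attribute [instance] ComoduleAlgebraCat.ring ComoduleAlgebraCat.algebra

/-- Left module coalgebras over the `R`-bialgebroid `H`. -/
structure ModuleCoalgebraCat where
  carrier : Type uC
  [group : AddCommGroup carrier]
  [modk : Module k carrier]
  [modH : Module H carrier]
  [tower : IsScalarTower k H carrier]
  str : ModuleCoalgebra B carrier

attribute [instance] ModuleCoalgebraCat.group ModuleCoalgebraCat.modk
  ModuleCoalgebraCat.modH ModuleCoalgebraCat.tower

variable {B}

/-- Morphisms of `R`-rings that are left `H`-colinear. -/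
@[ext] structure ComoduleAlgebraCat.Hom
    (X Y : ComoduleAlgebraCat.{uk, uR, uH, uA} B) where
  hom : X.carrier →ₐ[k] Y.carrier
  map_src : ∀ r, hom (X.str.src r) = Y.str.src r
  colinear : ∀ x, Y.str.comod.coact (hom x) =
    balMap LinearMap.id hom.toLinearMap (fun _ _ => rfl) (by intro r a; simp [map_src])
      (X.str.comod.coact x)

instance : Category (ComoduleAlgebraCat.{uk, uR, uH, uA} B) where
  Hom X Y := ComoduleAlgebraCat.Hom X Y
  id X := ⟨AlgHom.id k _, fun _ => rfl, by
    intro x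
    exact (balMap_id _ _ rfl rfl _).symm⟩
  comp {X Y Z} f g := ⟨g.hom.comp f.hom, by
    intro r
    rw [AlgHom.comp_apply, f.map_src, g.map_src], by
    intro x
    rw [AlgHom.comp_apply, g.colinear, f.colinear]
    exact balMap_balMap _ _ _ _ _ _ rfl rfl _⟩

/-- `H`-linear maps of `R`-corings. -/
@[ext] structure ModuleCoalgebraCat.Hom
    (X Y : ModuleCoalgebraCat.{uk, uR, uH, uC} B) where
  hom : X.carrier →ₗ[H] Y.carrier
  map_comul : ∀ x, Y.str.coring.comul (hom x) =
    balMap (hom.restrictScalars k) (hom.restrictScalars k) (by intro r a; simp)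
      (by intro r a; simp) (X.str.coring.comul x)
  map_counit : ∀ x, Y.str.coring.counit (hom x) = X.str.coring.counit x

instance : Category (ModuleCoalgebraCat.{uk, uR, uH, uC} B) where
  Hom X Y := ModuleCoalgebraCat.Hom X Y
  id X := ⟨LinearMap.id, by
    intro x
    exact (balMap_id _ _ rfl rfl _).symm, by intro x; rfl⟩
  comp {X Y Z} f g := ⟨g.hom.comp f.hom, by
    intro x
    rw [LinearMap.comp_apply, g.map_comul, f.map_comul]
    exact balMap_balMap _ _ _ _ _ _ rfl rfl _, by
    intro x
    rw [LinearMap.comp_apply, g.map_counit, f.map_counit]⟩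

variable (B) in
/-- The category of left-left Doi-Koppinen data `(H, A, C)_R` with fixed `R`-bialgebroid `H`. -/
abbrev DKDatum := ComoduleAlgebraCat.{uk, uR, uH, uA} B × ModuleCoalgebraCat.{uk, uR, uH, uC} B

variable (B) in
/-- `(H, A, C)_R ↦ (A, C)`, where `A` is regarded as an algebra and `C` as a left `H`-module. -/
def forgetDK : DKDatum.{uk, uR, uH, uA, uC} B ⥤ AlgCat.{uA} k × ModuleCat.{uC} H where
  obj D := (AlgCat.of k D.1.carrier, ModuleCat.of H D.2.carrier)
  map f := (AlgCat.ofHom f.1.hom, ModuleCat.ofHom f.2.hom)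

/-- Left-left Doi-Koppinen modules over `R` associated to a Doi-Koppinen datum over `R`. -/
structure DKModuleCat (D : DKDatum.{uk, uR, uH, uA, uC} B) where
  carrier : Type uM
  [group : AddCommGroup carrier]
  [modk : Module k carrier]
  [modA : Module D.1.carrier carrier]
  [tower : IsScalarTower k D.1.carrier carrier]
  str : DKModule D.1.str D.2.str carrier

attribute [instance] DKModuleCat.group DKModuleCat.modk DKModuleCat.modA DKModuleCat.tower

variable {D : DKDatum.{uk, uR, uH, uA, uC} B}

/-- `A`-linear and `C`-colinear maps. -/
@[ext] structure DKModuleCat.Hom (X Y : DKModuleCat.{uk, uR, uH, uA, uC, uM} D) where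
  hom : X.carrier →ₗ[D.1.carrier] Y.carrier
  colinear : ∀ x, Y.str.comod.coact (hom x) =
    balMap LinearMap.id (hom.restrictScalars k) (fun _ _ => rfl) (by intro r a; simp)
      (X.str.comod.coact x)

instance : Category (DKModuleCat.{uk, uR, uH, uA, uC, uM} D) where
  Hom X Y := DKModuleCat.Hom X Y
  id X := ⟨LinearMap.id, by
    intro x
    exact (balMap_id _ _ rfl rfl _).symm⟩
  comp {X Y Z} f g := ⟨g.hom.comp f.hom, by
    intro x
    rw [LinearMap.comp_apply, g.colinear, f.colinear]
    exact balMap_balMap _ _ _ _ _ _ rfl rfl _⟩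

variable (D) in
/-- The underlying left `A`-module of a Doi-Koppinen module. -/
def moduleForget : DKModuleCat.{uk, uR, uH, uA, uC, uM} D ⥤ ModuleCat.{uM} D.1.carrier where
  obj M := ModuleCat.of D.1.carrier M.carrier
  map f := ModuleCat.ofHom f.hom

end BialgebroidCategories

end Categories

/-- `F` is an isomorphism of categories (not merely an equivalence). -/
def IsCatIso {𝒞 𝒟 : Type*} [Category 𝒞] [Category 𝒟] (F : 𝒞 ⥤ 𝒟) : Prop :=
  ∃ G : 𝒟 ⥤ 𝒞, F ⋙ G = 𝟭 𝒞 ∧ G ⋙ F = 𝟭 𝒟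

section Comparison

open Coalgebra

variable {k : Type*} {H : Type*} [CommRing k] [Ring H] [Algebra k H]

/-- `B` is the bialgebroid structure over `R = Im Π^L` attached to the weak Hopf algebra `H` with
bijective antipode `S`: the source is the inclusion, the target is `S⁻¹`, the coproduct is
`h ↦ h₍₁₎ ⊗_R h₍₂₎`, the counit is `Π^L`. -/
structure IsAssociated [WeakHopfAlgebra k H]
    (hS : Function.Bijective (WeakHopfAlgebra.antipode (k := k) (H := H)))
    (B : Bialgebroid k (leftBase k H) H) : Prop where
  src_eq : ∀ r : leftBase k H, B.src r = (r : H)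
  tgt_eq : ∀ r : leftBase k H, B.tgt (.op r) = (LinearEquiv.ofBijective _ hS).symm (r : H)
  comul_eq : ∀ h : H, B.coring.comul h = can _ _ (comul (R := k) h)
  counit_eq : ∀ h : H, (B.coring.counit h : H) = piL k h

variable [WeakBialgebra k H] {B : Bialgebroid k (leftBase k H) H}

/-- The comodule algebra structure over `R` is obtained from the weak one by
`s(Π^L(h)) = ε(1₍₋₁₎ h) 1₍₀₎` and `a ↦ a₍₋₁₎ ⊗_R a₍₀₎`. -/
structure ComoduleAlgebra.IsInduced {A : Type*} [Ring A] [Algebra k A]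
    (a : ComoduleAlgebra B A) (w : WeakComoduleAlgebra k H A) : Prop where
  src_eq : ∀ h : H, a.src ⟨piL k h, Set.mem_range_self h⟩ =
    TensorProduct.lid k A ((counit (R := k) ∘ₗ LinearMap.mulRight k h).rTensor A (w.coact 1))
  coact_eq : ∀ x, a.comod.coact x = can _ _ (w.coact x)

/-- The module coalgebra structure over `R` is obtained from the weak one by
`c ↦ c₍₁₎ ⊗_R c₍₂₎` and `c ↦ ε(1₍₁₎ · c) 1₍₂₎`. -/
structure ModuleCoalgebra.IsInduced {C : Type*} [AddCommGroup C] [Module k C] [Module H C]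
    [IsScalarTower k H C] (c : ModuleCoalgebra B C) (w : WeakModuleCoalgebra k H C) : Prop where
  comul_eq : ∀ x, c.coring.comul x = can _ _ (w.coalg.comul x)
  counit_eq : ∀ x, (c.coring.counit x : H) = TensorProduct.lid k H
    ((w.coalg.counit ∘ₗ (Algebra.lsmul k k C : H →ₐ[k] Module.End k C).toLinearMap.flip x).rTensor H
      (comul (R := k) (1 : H)))

end Comparison

end

end DoiKoppinen

open DoiKoppinen

namespace DoiKoppinen

universe uk uH uA uC uM

noncomputable section

/-! ## Separable Frobenius algebras and the splitting of `M ⊗[k] N → M ⊗_R N` -/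

/-! The mechanism is that R = Im Π^L is a separable Frobenius k-algebra, with Casimir element read
off from Δ(1). With t(h) = 1₍₁₎ ε(1₍₂₎ h) one has Δ(1) = ∑ t(xᵢ) ⊗ yᵢ for elements xᵢ, yᵢ of R
satisfying ∑ r xᵢ ⊗ yᵢ = ∑ xᵢ ⊗ yᵢ r and ∑ xᵢ yᵢ = 1, and the counit restricted to R is a Frobenius
form for which they are dual bases (`exists_casimirSystem`).

Separability splits the projection M ⊗ N → M ⊗_R N by m ⊗ n ↦ ∑ m · xᵢ ⊗ yᵢ · n. So M ⊗_R N is the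
image of an idempotent on M ⊗ N, and the same holds for triple products (`eq_of_can₃_eq`). The
Frobenius form exchanges k-linear forms ε on C with right R-linear maps e : C → R, via ε = form ∘ e
and e(c) = ∑ ε(c · xᵢ) yᵢ. Hence an R-coring is the same as a k-coalgebra with R-bilinear coproduct
taking values in the image of the idempotent and whose lifted counit is left R-linear; comodules are
treated likewise.

For weak structures the invariance is automatic. On C ⊗ C the idempotent is the action of Δ(1), and
Δ(1) · Δ(c) = Δ(1 · c). On C ⊗ M it is the action of ∑ t(xᵢ) ⊗ s(yᵢ), which equals ρ(1) by the axiom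
on (H ⊗ ρ)ρ(1) (`WeakComoduleAlgebra.coact_one_eq`), and ρ(1) · ρ(m) = ρ(1 · m). Conversely,
sectioning a structure over R gives k-linear structure maps, and the weak axioms follow from
multiplicativity, because the representatives involved are already fixed by the idempotent. The two
passages are inverse because can ∘ sect is the identity and sect ∘ can is the idempotent.

Algebras, modules and underlying maps never change, so equality of composite functors with the
identity reduces to equality of objects. The antipode serves only to identify t on R with S⁻¹,
through S(t(r)) = r (`antipode_tgtLin`). -/

/-- A separability element `∑ xᵢ ⊗ yᵢ` of the `k`-algebra `R` together with a Frobenius form for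
which it is a pair of dual bases. -/
structure CasimirSystem (k : Type*) (R : Type*) [CommRing k] [Ring R] [Algebra k R] where
  n : ℕ
  x : Fin n → R
  y : Fin n → R
  form : R →ₗ[k] k
  casimir : ∀ r, ∑ i, (r * x i) ⊗ₜ[k] y i = ∑ i, x i ⊗ₜ[k] (y i * r)
  sum_mul : ∑ i, x i * y i = 1
  form_left : ∑ i, form (x i) • y i = 1
  form_right : ∑ i, form (y i) • x i = 1

namespace CasimirSystem

variable {k R : Type*} [CommRing k] [Ring R] [Algebra k R] (φ : CasimirSystem k R)
variable {M M' N N' P X Y Z : Type*}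
  [AddCommGroup M] [Module k M] [AddCommGroup M'] [Module k M']
  [AddCommGroup N] [Module k N] [AddCommGroup N'] [Module k N']
  [AddCommGroup P] [Module k P]
  [AddCommGroup X] [Module k X] [AddCommGroup Y] [Module k Y] [AddCommGroup Z] [Module k Z]

theorem casimir_apply (f : R →ₗ[k] R →ₗ[k] P) (r : R) :
    ∑ i, f (r * φ.x i) (φ.y i) = ∑ i, f (φ.x i) (φ.y i * r) := by
  have h := congrArg (TensorProduct.lift f) (φ.casimir r)
  simpa only [map_sum, TensorProduct.lift.tmul] using h

/-- The Casimir identity moves r to the right of yᵢ, where it multiplies ∑ form(xᵢ) yᵢ = 1. Together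
with its mirror image this is the dual basis expansion. -/
theorem form_mul_left (r : R) : ∑ i, φ.form (r * φ.x i) • φ.y i = r := by
  have h := φ.casimir_apply ((LinearMap.lsmul k R).comp φ.form) r
  simp only [LinearMap.comp_apply, LinearMap.lsmul_apply] at h
  rw [h]
  simp_rw [← smul_mul_assoc]
  rw [← Finset.sum_mul, φ.form_left, one_mul]

theorem form_mul_right (r : R) : ∑ i, φ.form (φ.y i * r) • φ.x i = r := by
  have h := φ.casimir_apply ((LinearMap.lsmul k R).comp φ.form).flip r
  simp only [LinearMap.comp_apply, LinearMap.flip_apply, LinearMap.lsmul_apply] at h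
  rw [← h]
  simp_rw [← mul_smul_comm]
  rw [← Finset.mul_sum, φ.form_right, mul_one]

/-- `m ⊗ n ↦ ∑ m · xᵢ ⊗ yᵢ · n`. -/
def proj (p : RightAct k R M) (q : LeftAct k R N) : M ⊗[k] N →ₗ[k] M ⊗[k] N :=
  ∑ i, TensorProduct.map (p (.op (φ.x i))) (q (φ.y i))

@[simp] theorem proj_tmul (p : RightAct k R M) (q : LeftAct k R N) (m : M) (n : N) :
    φ.proj p q (m ⊗ₜ n) = ∑ i, p (.op (φ.x i)) m ⊗ₜ q (φ.y i) n := by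
  simp [proj]

/-- Exactly the Casimir identity: m · r xᵢ ⊗ yᵢ · n = m · xᵢ ⊗ yᵢ r · n after summation. It lets
`proj` descend to the balanced tensor product. -/
theorem proj_bal (p : RightAct k R M) (q : LeftAct k R N) (r : R) (m : M) (n : N) :
    φ.proj p q (p (.op r) m ⊗ₜ n) = φ.proj p q (m ⊗ₜ q r n) := by
  have h := φ.casimir_apply
    (((TensorProduct.mk k M N).compl₂ (q.toLinearMap.flip n)).comp
      (p.toLinearMap.flip m ∘ₗ (MulOpposite.opLinearEquiv k).toLinearMap)) r
  simpa using h

/-- Over R the xᵢ may be moved across the tensor sign, and ∑ xᵢ yᵢ = 1. -/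
theorem can_proj (p : RightAct k R M) (q : LeftAct k R N) (w : M ⊗[k] N) :
    can p q (φ.proj p q w) = can p q w := by
  induction w using TensorProduct.induction_on with
  | zero => simp
  | add a b ha hb => simp only [map_add, ha, hb]
  | tmul m n =>
    simp only [proj_tmul, map_sum, can_bal]
    simp only [← map_sum, ← TensorProduct.tmul_sum]
    congr 2
    simp only [← Module.End.mul_apply, ← map_mul, ← LinearMap.sum_apply, ← map_sum, φ.sum_mul]
    simp

/-- The section `[m ⊗ n] ↦ ∑ m · xᵢ ⊗ yᵢ · n` of the projection `M ⊗[k] N → M ⊗_R N`. -/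
def sect (p : RightAct k R M) (q : LeftAct k R N) : BalTensor p q →ₗ[k] M ⊗[k] N :=
  balLift (φ.proj p q) (φ.proj_bal p q)

@[simp] theorem sect_can (p : RightAct k R M) (q : LeftAct k R N) (w : M ⊗[k] N) :
    φ.sect p q (can p q w) = φ.proj p q w := rfl

@[simp] theorem can_sect (p : RightAct k R M) (q : LeftAct k R N) (x : BalTensor p q) :
    can p q (φ.sect p q x) = x := by
  obtain ⟨w, rfl⟩ := Submodule.mkQ_surjective _ x
  exact φ.can_proj p q w

@[simp] theorem proj_sect (p : RightAct k R M) (q : LeftAct k R N) (x : BalTensor p q) :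
    φ.proj p q (φ.sect p q x) = φ.sect p q x := by
  rw [← sect_can, can_sect]

theorem sect_balMap {p : RightAct k R M} {q : LeftAct k R N} {p' : RightAct k R M'}
    {q' : LeftAct k R N'} (f : M →ₗ[k] M') (g : N →ₗ[k] N')
    (hf : ∀ r m, f (p (.op r) m) = p' (.op r) (f m)) (hg : ∀ r n, g (q r n) = q' r (g n))
    (x : BalTensor p q) :
    φ.sect p' q' (balMap f g hf hg x) = TensorProduct.map f g (φ.sect p q x) := by
  obtain ⟨w, rfl⟩ := Submodule.mkQ_surjective _ x
  change φ.sect p' q' (balMap f g hf hg (can p q w)) =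
    TensorProduct.map f g (φ.sect p q (can p q w))
  rw [balMap_can, sect_can, sect_can]
  induction w using TensorProduct.induction_on with
  | zero => simp
  | add a b ha hb => simp only [map_add, ha, hb]
  | tmul m n => simp [hf, hg]

/-! ### Injectivity of the triple projection on invariant elements -/

/-- The projection on the first two factors of `X ⊗ Y ⊗ Z`. -/
def projLeft (p : RightAct k R X) (l : LeftAct k R Y) (Z : Type*) [AddCommGroup Z] [Module k Z] :
    X ⊗[k] (Y ⊗[k] Z) →ₗ[k] X ⊗[k] (Y ⊗[k] Z) :=
  ∑ i, TensorProduct.map (p (.op (φ.x i))) ((l (φ.y i)).rTensor Z)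

@[simp] theorem projLeft_tmul (p : RightAct k R X) (l : LeftAct k R Y) (x : X) (w : Y ⊗[k] Z) :
    φ.projLeft p l Z (x ⊗ₜ w) = ∑ i, p (.op (φ.x i)) x ⊗ₜ (l (φ.y i)).rTensor Z w := by
  simp [projLeft]

/-- The product of the two partial idempotents kills every relation of X ⊗_R Y ⊗_R Z, so its kernel
contains that of `can₃`; elements fixed by both idempotents are therefore determined by their class.
This lifts coassociativity from R back to k. -/
theorem eq_of_can₃_eq (p : RightAct k R X) (b : Bimod k R Y) (q : LeftAct k R Z)
    {w w' : X ⊗[k] (Y ⊗[k] Z)} (h : can₃ p b q w = can₃ p b q w')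
    (hl : φ.projLeft p b.l Z w = w) (hr : (φ.proj b.r q).lTensor X w = w)
    (hl' : φ.projLeft p b.l Z w' = w') (hr' : (φ.proj b.r q).lTensor X w' = w') : w = w' := by
  have key : balancedRel₃ p b q ≤
      LinearMap.ker ((φ.proj b.r q).lTensor X ∘ₗ φ.projLeft p b.l Z) := by
    refine Submodule.span_le.2 ?_
    rintro _ (⟨r, x, y, z, rfl⟩ | ⟨r, x, y, z, rfl⟩)
    · rw [SetLike.mem_coe, LinearMap.mem_ker, LinearMap.comp_apply]
      suffices h : φ.projLeft p b.l Z (p (.op r) x ⊗ₜ (y ⊗ₜ z)) =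
          φ.projLeft p b.l Z (x ⊗ₜ (b.l r y ⊗ₜ z)) by rw [map_sub, h, sub_self, map_zero]
      have h := congrArg (fun w => TensorProduct.assoc k X Y Z (w ⊗ₜ z)) (φ.proj_bal p b.l r x y)
      simpa [TensorProduct.sum_tmul] using h
    -- The bimodule condition on Y lets the right action of r pass the left action of yᵢ, after
    -- which the idempotent on Y ⊗ Z identifies the two terms.
    · rw [SetLike.mem_coe, LinearMap.mem_ker, LinearMap.comp_apply, map_sub, map_sub, sub_eq_zero]
      simp only [projLeft_tmul, map_sum, LinearMap.lTensor_tmul, LinearMap.rTensor_tmul, b.comm,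
        φ.proj_bal]
  rw [← sub_eq_zero, ← map_sub, ← LinearMap.mem_ker, Submodule.ker_mkQ] at h
  have h2 := key h
  rw [LinearMap.mem_ker, LinearMap.comp_apply, map_sub, hl, hl', map_sub, hr, hr',
    sub_eq_zero] at h2
  exact h2

/-- Linearity of ρ turns the action of yᵢ on the first factor of ρ(n) into its action on n. This and
the next lemmas supply the invariance required for lifting coassociativity. -/
theorem projLeft_lTensor (p : RightAct k R X) (l : LeftAct k R Y) (q : LeftAct k R N)
    (ρ : N →ₗ[k] Y ⊗[k] Z) (hρ : ∀ r n, ρ (q r n) = (l r).rTensor Z (ρ n)) (w : X ⊗[k] N) :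
    φ.projLeft p l Z (ρ.lTensor X w) = ρ.lTensor X (φ.proj p q w) := by
  induction w using TensorProduct.induction_on with
  | zero => simp
  | add a b ha hb => simp only [map_add, ha, hb]
  | tmul x n => simp [hρ]

theorem projRight_rTensor (p : RightAct k R N) (r : RightAct k R Y) (q : LeftAct k R Z)
    (δ : N →ₗ[k] X ⊗[k] Y) (hδ : ∀ s n, δ (p (.op s) n) = (r (.op s)).lTensor X (δ n))
    (w : N ⊗[k] Z) :
    (φ.proj r q).lTensor X (TensorProduct.assoc k X Y Z (δ.rTensor Z w)) =
      TensorProduct.assoc k X Y Z (δ.rTensor Z (φ.proj p q w)) := by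
  induction w using TensorProduct.induction_on with
  | zero => simp
  | add a b ha hb => simp only [map_add, ha, hb]
  | tmul n z =>
    simp only [LinearMap.rTensor_tmul, proj_tmul, map_sum, hδ]
    generalize δ n = v
    induction v using TensorProduct.induction_on with
    | zero => simp
    | add a b ha hb => simp only [map_add, TensorProduct.add_tmul, ha, hb, Finset.sum_add_distrib]
    | tmul x y => simp [TensorProduct.tmul_sum]

theorem projLeft_assoc (p : RightAct k R X) (l : LeftAct k R Y) (w : X ⊗[k] Y) (z : Z) :
    φ.projLeft p l Z (TensorProduct.assoc k X Y Z (w ⊗ₜ z)) =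
      TensorProduct.assoc k X Y Z (φ.proj p l w ⊗ₜ z) := by
  induction w using TensorProduct.induction_on with
  | zero => simp
  | add a b ha hb => simp only [map_add, TensorProduct.add_tmul, ha, hb]
  | tmul x y => simp [TensorProduct.sum_tmul]

theorem projLeft_rTensor (p : RightAct k R X) (l : LeftAct k R Y)
    (δ : N →ₗ[k] X ⊗[k] Y) (hδ : ∀ n, φ.proj p l (δ n) = δ n) (w : N ⊗[k] Z) :
    φ.projLeft p l Z (TensorProduct.assoc k X Y Z (δ.rTensor Z w)) =
      TensorProduct.assoc k X Y Z (δ.rTensor Z w) := by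
  induction w using TensorProduct.induction_on with
  | zero => simp
  | add a b ha hb => simp only [map_add, ha, hb]
  | tmul n z => rw [LinearMap.rTensor_tmul, projLeft_assoc, hδ]

theorem projRight_lTensor (r : RightAct k R Y) (q : LeftAct k R Z)
    (ρ : N →ₗ[k] Y ⊗[k] Z) (hρ : ∀ n, φ.proj r q (ρ n) = ρ n) (w : X ⊗[k] N) :
    (φ.proj r q).lTensor X (ρ.lTensor X w) = ρ.lTensor X w := by
  rw [← LinearMap.comp_apply, ← LinearMap.lTensor_comp]
  congr 2
  ext n
  exact hρ n

end CasimirSystem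

/-! ### Whiskered maps computed on k-linear representatives -/

section Whisker

variable {k R : Type*} [CommRing k] [Ring R] [Algebra k R]
variable {N X Y Z : Type*} [AddCommGroup N] [Module k N]
  [AddCommGroup X] [Module k X] [AddCommGroup Y] [Module k Y] [AddCommGroup Z] [Module k Z]

theorem whiskerL_can (p : RightAct k R X) {b : Bimod k R Y} {q : LeftAct k R Z}
    {qN : LeftAct k R N} (f : N →ₗ[k] BalTensor b.r q)
    (hf : ∀ r n, f (qN r n) = balLeftMul b q r (f n)) (ρ : N →ₗ[k] Y ⊗[k] Z)
    (h : ∀ n, f n = can _ _ (ρ n)) (w : X ⊗[k] N) :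
    whiskerL p f hf (can p qN w) = can₃ p b q (ρ.lTensor X w) := by
  induction w using TensorProduct.induction_on with
  | zero => simp
  | add a b ha hb => simp only [map_add, ha, hb]
  | tmul x n =>
    change consLeft p b q x (f n) = _
    rw [h, consLeft_can, LinearMap.lTensor_tmul]

theorem whiskerR_can {p : RightAct k R X} {b : Bimod k R Y} (q : LeftAct k R Z)
    {pN : RightAct k R N} (f : N →ₗ[k] BalTensor p b.l)
    (hf : ∀ r n, f (pN (.op r) n) = balRightMul p b r (f n)) (δ : N →ₗ[k] X ⊗[k] Y)
    (h : ∀ n, f n = can _ _ (δ n)) (w : N ⊗[k] Z) :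
    whiskerR q f hf (can pN q w) = can₃ p b q (TensorProduct.assoc k X Y Z (δ.rTensor Z w)) := by
  induction w using TensorProduct.induction_on with
  | zero => simp
  | add a b ha hb => simp only [map_add, ha, hb]
  | tmul n z =>
    change consRight p b q (f n) z = _
    rw [h, consRight_can, LinearMap.rTensor_tmul]

end Whisker

/-! ## Corings over a separable Frobenius algebra -/

namespace CasimirSystem

variable {k R : Type*} [CommRing k] [Ring R] [Algebra k R] (φ : CasimirSystem k R)
variable {C M X Y Z : Type*} [AddCommGroup C] [Module k C] [AddCommGroup M] [Module k M]
  [AddCommGroup X] [Module k X] [AddCommGroup Y] [Module k Y] [AddCommGroup Z] [Module k Z]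

theorem balLeftMul_can (b : Bimod k R Y) (q : LeftAct k R Z) (r : R) (w : Y ⊗[k] Z) :
    balLeftMul b q r (can b.r q w) = can b.r q ((b.l r).rTensor Z w) := rfl

theorem balRightMul_can (p : RightAct k R X) (b : Bimod k R Y) (r : R) (w : X ⊗[k] Y) :
    balRightMul p b r (can p b.l w) = can p b.l ((b.r (.op r)).lTensor X w) := rfl

theorem sect_balLeftMul (b : Bimod k R Y) (q : LeftAct k R Z) (r : R) (w : BalTensor b.r q) :
    φ.sect b.r q (balLeftMul b q r w) = (b.l r).rTensor Z (φ.sect b.r q w) :=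
  φ.sect_balMap ..

theorem sect_balRightMul (p : RightAct k R X) (b : Bimod k R Y) (r : R) (w : BalTensor p b.l) :
    φ.sect p b.l (balRightMul p b r w) = (b.r (.op r)).lTensor X (φ.sect p b.l w) :=
  φ.sect_balMap ..

/-- The map `c ↦ ∑ ε(c · xᵢ) yᵢ` with values in `R`. -/
def liftForm (p : RightAct k R C) (ε : C →ₗ[k] k) : C →ₗ[k] R :=
  ∑ i, (ε ∘ₗ p (.op (φ.x i))).smulRight (φ.y i)

theorem liftForm_apply (p : RightAct k R C) (ε : C →ₗ[k] k) (c : C) :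
    φ.liftForm p ε c = ∑ i, ε (p (.op (φ.x i)) c) • φ.y i := by
  simp [liftForm]

theorem liftForm_right (p : RightAct k R C) (ε : C →ₗ[k] k) (r : R) (c : C) :
    φ.liftForm p ε (p (.op r) c) = φ.liftForm p ε c * r := by
  have h := φ.casimir_apply ((LinearMap.lsmul k R).comp
    (ε ∘ₗ p.toLinearMap.flip c ∘ₗ (MulOpposite.opLinearEquiv k).toLinearMap)) r
  simpa [liftForm_apply, Finset.sum_mul] using h

/-- Summing inside ε gives ε(c · ∑ form(yᵢ) xᵢ) = ε(c). With `liftForm_form` this makes k-linear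
forms and right R-linear maps C → R correspond bijectively. -/
theorem form_liftForm (p : RightAct k R C) (ε : C →ₗ[k] k) (c : C) :
    φ.form (φ.liftForm p ε c) = ε c := by
  rw [liftForm_apply]
  have h := congrArg (fun r => ε (p (.op r) c)) φ.form_right
  simp only [Finset.op_sum, MulOpposite.op_smul, map_sum, map_smul, LinearMap.sum_apply,
    LinearMap.smul_apply, MulOpposite.op_one, map_one, Module.End.one_apply] at h
  rw [← h, map_sum]
  refine Finset.sum_congr rfl fun i _ => ?_
  rw [map_smul, smul_eq_mul, smul_eq_mul, mul_comm]

theorem liftForm_form (p : RightAct k R C) (e : C →ₗ[k] R) (he : ∀ r c, e (p (.op r) c) = e c * r)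
    (c : C) : φ.liftForm p (φ.form ∘ₗ e) c = e c := by
  rw [liftForm_apply]
  simp only [LinearMap.comp_apply, he, form_mul_left]

/-- Expanding e(c) in dual bases, e(c) · m = ∑ form(e(c) xᵢ) yᵢ · m. So on elements fixed by the
idempotent the counit axioms over R and over k coincide. -/
theorem counitL_can {p : RightAct k R C} (e : C →ₗ[k] R) (he : ∀ r c, e (p (.op r) c) = e c * r)
    (q : LeftAct k R M) (ε : C →ₗ[k] k) (hε : ∀ c, φ.form (e c) = ε c) (w : C ⊗[k] M) :
    counitL e he q (can p q w) = TensorProduct.lid k M (ε.rTensor M (φ.proj p q w)) := by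
  change TensorProduct.lift (q.toLinearMap ∘ₗ e) w = _
  induction w using TensorProduct.induction_on with
  | zero => simp
  | add a b ha hb => simp only [map_add, ha, hb]
  | tmul c m =>
    simp only [proj_tmul, map_sum, LinearMap.rTensor_tmul, TensorProduct.lid_tmul, ← hε, he]
    have h := congrArg (fun r => q r m) (φ.form_mul_left (e c))
    simpa using h.symm

theorem counitR_can {q : LeftAct k R C} (e : C →ₗ[k] R) (he : ∀ r c, e (q r c) = r * e c)
    (p : RightAct k R M) (ε : C →ₗ[k] k) (hε : ∀ c, φ.form (e c) = ε c) (w : M ⊗[k] C) :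
    counitR e he p (can p q w) = TensorProduct.rid k M (ε.lTensor M (φ.proj p q w)) := by
  change TensorProduct.lift _ w = _
  induction w using TensorProduct.induction_on with
  | zero => simp
  | add a b ha hb => simp only [map_add, ha, hb]
  | tmul m c =>
    simp only [proj_tmul, map_sum, LinearMap.lTensor_tmul, TensorProduct.rid_tmul, ← hε, he]
    have h := congrArg (fun r => p (.op r) m) (φ.form_mul_right (e c))
    simpa using h.symm

/-- A `k`-coalgebra with `R`-bilinear coproduct whose values are invariant under the projection
onto the `R`-balanced part is an `R`-coring. -/
def coringOfCoalgebra (b : Bimod k R C) (cc : Coalgebra k C)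
    (hproj : ∀ c, φ.proj b.r b.l (cc.comul c) = cc.comul c)
    (hl : ∀ r c, cc.comul (b.l r c) = (b.l r).rTensor C (cc.comul c))
    (hr : ∀ r c, cc.comul (b.r (.op r) c) = (b.r (.op r)).lTensor C (cc.comul c))
    (hε : ∀ r c, φ.liftForm b.r cc.counit (b.l r c) = r * φ.liftForm b.r cc.counit c) :
    Coring b where
  comul := can b.r b.l ∘ₗ cc.comul
  counit := φ.liftForm b.r cc.counit
  comul_left r c := by rw [LinearMap.comp_apply, hl, LinearMap.comp_apply, balLeftMul_can]
  comul_right r c := by rw [LinearMap.comp_apply, hr, LinearMap.comp_apply, balRightMul_can]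
  counit_left := hε
  counit_right := φ.liftForm_right b.r cc.counit
  coassoc c := by
    rw [LinearMap.comp_apply, whiskerR_can _ _ _ cc.comul fun _ => rfl,
      whiskerL_can _ _ _ cc.comul fun _ => rfl]
    exact congrArg _ (Coalgebra.coassoc_apply c)
  counit_comul c := by
    rw [LinearMap.comp_apply, φ.counitL_can _ _ _ cc.counit (φ.form_liftForm b.r cc.counit), hproj]
    rw [Coalgebra.rTensor_counit_comul, TensorProduct.lid_tmul, one_smul]
  comul_counit c := by
    rw [LinearMap.comp_apply, φ.counitR_can _ _ _ cc.counit (φ.form_liftForm b.r cc.counit), hproj]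
    rw [Coalgebra.lTensor_counit_comul, TensorProduct.rid_tmul, one_smul]

/-- The `k`-coalgebra underlying an `R`-coring. -/
@[reducible] def coalgebraOfCoring {b : Bimod k R C} (D : Coring b) : Coalgebra k C where
  comul := φ.sect b.r b.l ∘ₗ D.comul
  counit := φ.form ∘ₗ D.counit
  coassoc := by
    ext c
    have hl : ∀ r c, (φ.sect b.r b.l ∘ₗ D.comul) (b.l r c) =
        (b.l r).rTensor C ((φ.sect b.r b.l ∘ₗ D.comul) c) := fun r c => by
      rw [LinearMap.comp_apply, D.comul_left, sect_balLeftMul, LinearMap.comp_apply]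
    have hr : ∀ r c, (φ.sect b.r b.l ∘ₗ D.comul) (b.r (.op r) c) =
        (b.r (.op r)).lTensor C ((φ.sect b.r b.l ∘ₗ D.comul) c) := fun r c => by
      rw [LinearMap.comp_apply, D.comul_right, sect_balRightMul, LinearMap.comp_apply]
    have hc : ∀ c, D.comul c = can b.r b.l ((φ.sect b.r b.l ∘ₗ D.comul) c) := fun c => by
      rw [LinearMap.comp_apply, can_sect]
    have hp : ∀ c, φ.proj b.r b.l ((φ.sect b.r b.l ∘ₗ D.comul) c) =
        (φ.sect b.r b.l ∘ₗ D.comul) c := fun c => by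
      rw [LinearMap.comp_apply, proj_sect]
    -- Coassociativity over R equates the classes of both sides. Each side is fixed by both
    -- idempotents: by one because the coproduct is R-linear, by the other because its values are
    -- invariant.
    refine φ.eq_of_can₃_eq b.r b b.l ?_ ?_ ?_ ?_ ?_
    · have h := D.coassoc c
      rwa [hc c, whiskerR_can _ _ _ _ hc, whiskerL_can _ _ _ _ hc] at h
    · exact φ.projLeft_rTensor _ _ _ hp _
    · refine (φ.projRight_rTensor b.r b.r b.l _ hr _).trans ?_
      rw [hp]; rfl
    · refine (φ.projLeft_lTensor b.r b.l b.l _ hl _).trans ?_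
      rw [hp]; rfl
    · exact φ.projRight_lTensor _ _ _ hp _
  rTensor_counit_comp_comul := by
    ext c
    apply (TensorProduct.lid k C).injective
    have h := φ.counitL_can D.counit D.counit_right b.l (φ.form ∘ₗ D.counit) (fun _ => rfl)
      (φ.sect b.r b.l (D.comul c))
    rw [can_sect, D.counit_comul, proj_sect] at h
    simpa using h.symm
  lTensor_counit_comp_comul := by
    ext c
    apply (TensorProduct.rid k C).injective
    have h := φ.counitR_can D.counit D.counit_left b.r (φ.form ∘ₗ D.counit) (fun _ => rfl)
      (φ.sect b.r b.l (D.comul c))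
    rw [can_sect, D.comul_counit, proj_sect] at h
    simpa using h.symm

/-- A comodule over the `k`-coalgebra underlying the `R`-coring `D`, with left `R`-linear coaction
whose values are invariant under the projection onto the `R`-balanced part, is a comodule
over `D`. -/
def comoduleOfCoact {b : Bimod k R C} (D : Coring b) (q : LeftAct k R M)
    (δ : C →ₗ[k] C ⊗[k] C) (ε : C →ₗ[k] k) (hδ : ∀ c, D.comul c = can b.r b.l (δ c))
    (hε : ∀ c, φ.form (D.counit c) = ε c) (ρ : M →ₗ[k] C ⊗[k] M)
    (hproj : ∀ m, φ.proj b.r q (ρ m) = ρ m)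
    (hl : ∀ r m, ρ (q r m) = (b.l r).rTensor M (ρ m))
    (hcoassoc : ∀ m, ρ.lTensor C (ρ m) = TensorProduct.assoc k C C M (δ.rTensor M (ρ m)))
    (hcounit : ∀ m, TensorProduct.lid k M (ε.rTensor M (ρ m)) = m) : LeftComodule D q where
  coact := can b.r q ∘ₗ ρ
  coact_left r m := by rw [LinearMap.comp_apply, hl, LinearMap.comp_apply, balLeftMul_can]
  coassoc m := by
    rw [LinearMap.comp_apply, whiskerL_can _ _ _ ρ fun _ => rfl, whiskerR_can _ _ _ δ hδ, hcoassoc]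
  counit_coact m := by
    rw [LinearMap.comp_apply, φ.counitL_can _ _ _ ε hε, hproj, hcounit]

section LeftComodule

variable {b : Bimod k R C} {D : Coring b} {q : LeftAct k R M} (m : LeftComodule D q)

/-- The `k`-linear coaction underlying a comodule over an `R`-coring. -/
def liftCoact : M →ₗ[k] C ⊗[k] M := φ.sect b.r q ∘ₗ m.coact

theorem can_liftCoact (x : M) : can b.r q (φ.liftCoact m x) = m.coact x := φ.can_sect _ _ _

theorem proj_liftCoact (x : M) : φ.proj b.r q (φ.liftCoact m x) = φ.liftCoact m x :=
  φ.proj_sect _ _ _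

theorem liftCoact_left (r : R) (x : M) :
    φ.liftCoact m (q r x) = (b.l r).rTensor M (φ.liftCoact m x) := by
  rw [liftCoact, LinearMap.comp_apply, m.coact_left, sect_balLeftMul, LinearMap.comp_apply]

theorem liftCoact_coassoc (δ : C →ₗ[k] C ⊗[k] C) (hδ : ∀ c, φ.sect b.r b.l (D.comul c) = δ c)
    (x : M) : (φ.liftCoact m).lTensor C (φ.liftCoact m x) =
      TensorProduct.assoc k C C M (δ.rTensor M (φ.liftCoact m x)) := by
  have hc : ∀ c, D.comul c = can b.r b.l (δ c) := fun c => by rw [← hδ, can_sect]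
  refine φ.eq_of_can₃_eq b.r b q ?_ ?_ ?_ ?_ ?_
  · have h := m.coassoc x
    rwa [← φ.can_liftCoact m x,
      whiskerL_can _ _ _ (φ.liftCoact m) fun x => (φ.can_liftCoact m x).symm,
      whiskerR_can _ _ _ _ hc] at h
  · rw [φ.projLeft_lTensor b.r b.l q _ (φ.liftCoact_left m), proj_liftCoact]
  · exact φ.projRight_lTensor _ _ _ (φ.proj_liftCoact m) _
  · exact φ.projLeft_rTensor _ _ _ (fun c => by rw [← hδ, proj_sect]) _
  · refine (φ.projRight_rTensor b.r b.r q _ (fun r c => ?_) _).trans ?_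
    · rw [← hδ, ← hδ, D.comul_right, sect_balRightMul]
    · rw [proj_liftCoact]

theorem liftCoact_counit (ε : C →ₗ[k] k) (hε : ∀ c, φ.form (D.counit c) = ε c) (x : M) :
    TensorProduct.lid k M (ε.rTensor M (φ.liftCoact m x)) = x := by
  have h := φ.counitL_can D.counit D.counit_right q ε hε (φ.liftCoact m x)
  rw [can_liftCoact, m.counit_coact, proj_liftCoact] at h
  exact h.symm

end LeftComodule

end CasimirSystem

/-! ## The base algebra of a weak bialgebra -/

section Base

open Coalgebra

variable {k : Type*} {H : Type*} [CommRing k] [Ring H] [Algebra k H]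

theorem exists_sum_tmul {M N : Type*} [AddCommGroup M] [Module k M] [AddCommGroup N] [Module k N]
    (w : M ⊗[k] N) : ∃ (n : ℕ) (a : Fin n → M) (b : Fin n → N), w = ∑ i, a i ⊗ₜ b i := by
  obtain ⟨s, hs⟩ := TensorProduct.exists_finset w
  refine ⟨s.card, fun i => (s.equivFin.symm i).1.1, fun i => (s.equivFin.symm i).1.2, ?_⟩
  rw [hs, ← Finset.sum_coe_sort s fun i => i.1 ⊗ₜ[k] i.2]
  exact (Equiv.sum_comp s.equivFin.symm fun i : s => i.1.1 ⊗ₜ[k] i.1.2).symm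

variable [WeakBialgebra k H]

/-! ### Identities for Δ(1) in coordinates -/

section Rep

variable {n : ℕ} {a b : Fin n → H}

theorem piL_eq_sum (hab : comul (R := k) (1 : H) = ∑ i, a i ⊗ₜ b i) (g : H) :
    piL k g = ∑ i, counit (R := k) (a i * g) • b i := by
  simp [piL, hab]

theorem piR_eq_sum (hab : comul (R := k) (1 : H) = ∑ i, a i ⊗ₜ b i) (g : H) :
    piR k g = ∑ i, counit (R := k) (g * b i) • a i := by
  simp [piR, hab]

theorem comul_comul_one_sum (hab : comul (R := k) (1 : H) = ∑ i, a i ⊗ₜ b i) :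
    ∑ i, TensorProduct.assoc k H H H (comul (a i) ⊗ₜ b i) =
      ∑ i, ∑ j, a i ⊗ₜ[k] ((b i * a j) ⊗ₜ[k] b j) := by
  have h := WeakBialgebra.comul_comul_one (k := k) (H := H)
  rw [hab] at h
  simp only [map_sum, TensorProduct.sum_tmul, TensorProduct.tmul_sum, Finset.sum_mul,
    LinearMap.rTensor_tmul, Finset.mul_sum, TensorProduct.assoc_tmul,
    Algebra.TensorProduct.tmul_mul_tmul, one_mul, mul_one] at h
  rw [h, Finset.sum_comm]

theorem comul_comul_one_sum' (hab : comul (R := k) (1 : H) = ∑ i, a i ⊗ₜ b i) :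
    ∑ i, TensorProduct.assoc k H H H (comul (a i) ⊗ₜ b i) =
      ∑ i, ∑ j, a i ⊗ₜ[k] ((a j * b i) ⊗ₜ[k] b j) := by
  have h := WeakBialgebra.comul_comul_one' (k := k) (H := H)
  rw [hab] at h
  simp only [map_sum, TensorProduct.sum_tmul, TensorProduct.tmul_sum, Finset.sum_mul,
    LinearMap.rTensor_tmul, Finset.mul_sum, TensorProduct.assoc_tmul,
    Algebra.TensorProduct.tmul_mul_tmul, one_mul, mul_one] at h
  exact h

theorem counit_mul_sum (hab : comul (R := k) (1 : H) = ∑ i, a i ⊗ₜ b i) (x z : H) :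
    counit (R := k) (x * z) = ∑ i, counit (R := k) (x * a i) * counit (R := k) (b i * z) := by
  have h := WeakBialgebra.counit_mul_mul (k := k) x 1 z
  simpa [hab] using h

theorem counit_mul_sum' (hab : comul (R := k) (1 : H) = ∑ i, a i ⊗ₜ b i) (x z : H) :
    counit (R := k) (x * z) = ∑ i, counit (R := k) (a i * z) * counit (R := k) (x * b i) := by
  have h := WeakBialgebra.counit_mul_mul' (k := k) x 1 z
  simpa [hab] using h

theorem sum_counit_smul (hab : comul (R := k) (1 : H) = ∑ i, a i ⊗ₜ b i) :
    ∑ i, counit (R := k) (a i) • b i = 1 := by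
  have h := rTensor_counit_comul (R := k) (1 : H)
  rw [hab] at h
  simpa using congrArg (TensorProduct.lid k H) h

theorem sum_smul_counit (hab : comul (R := k) (1 : H) = ∑ i, a i ⊗ₜ b i) :
    ∑ i, counit (R := k) (b i) • a i = 1 := by
  have h := lTensor_counit_comul (R := k) (1 : H)
  rw [hab] at h
  simpa using congrArg (TensorProduct.rid k H) h

theorem assoc_contract_middle (u : H ⊗[k] H) (v : H) :
    ((TensorProduct.lid k H).toLinearMap ∘ₗ counit.rTensor H).lTensor H
      (TensorProduct.assoc k H H H (u ⊗ₜ v)) =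
      TensorProduct.rid k H (counit.lTensor H u) ⊗ₜ v := by
  induction u using TensorProduct.induction_on with
  | zero => simp
  | add x y hx hy => simp only [map_add, TensorProduct.add_tmul, hx, hy]
  | tmul x y => simp [TensorProduct.smul_tmul]

/-- Apply the counit to the middle leg of the first formula for (Δ ⊗ H)Δ(1). It yields Δ(1) = ∑
t(aⱼ) ⊗ bⱼ; the primed version, from the second formula, puts the second leg of Δ(1) in R. -/
theorem sum_counit_mul (hab : comul (R := k) (1 : H) = ∑ i, a i ⊗ₜ b i) :
    ∑ i, ∑ j, counit (R := k) (b i * a j) • a i ⊗ₜ[k] b j = ∑ i, a i ⊗ₜ[k] b i := by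
  have h := congrArg (((TensorProduct.lid k H).toLinearMap ∘ₗ counit.rTensor H).lTensor H)
    (comul_comul_one_sum hab)
  simp only [map_sum, assoc_contract_middle, lTensor_counit_comul, TensorProduct.rid_tmul,
    one_smul] at h
  rw [h]
  simp [TensorProduct.smul_tmul']

theorem sum_counit_mul' (hab : comul (R := k) (1 : H) = ∑ i, a i ⊗ₜ b i) :
    ∑ i, ∑ j, counit (R := k) (a j * b i) • a i ⊗ₜ[k] b j = ∑ i, a i ⊗ₜ[k] b i := by
  have h := congrArg (((TensorProduct.lid k H).toLinearMap ∘ₗ counit.rTensor H).lTensor H)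
    (comul_comul_one_sum' hab)
  simp only [map_sum, assoc_contract_middle, lTensor_counit_comul, TensorProduct.rid_tmul,
    one_smul] at h
  rw [h]
  simp [TensorProduct.smul_tmul']

theorem sum_tmul_piL (hab : comul (R := k) (1 : H) = ∑ i, a i ⊗ₜ b i) :
    comul (R := k) (1 : H) = ∑ i, a i ⊗ₜ piL k (b i) := by
  simp only [piL_eq_sum hab, TensorProduct.tmul_sum]
  rw [hab]
  conv_lhs => rw [← sum_counit_mul' hab]
  simp

/-- This is the axiom ε(x y z) = ε(x y₍₂₎) ε(y₍₁₎ z) at y = 1. -/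
theorem counit_mul_piL (x g : H) : counit (R := k) (x * piL k g) = counit (R := k) (x * g) := by
  obtain ⟨n, a, b, hab⟩ := exists_sum_tmul (comul (R := k) (1 : H))
  rw [counit_mul_sum' hab x g, piL_eq_sum hab]
  simp [Finset.mul_sum]

theorem piL_mul_piL (x g : H) : piL k (x * piL k g) = piL k (x * g) := by
  obtain ⟨n, a, b, hab⟩ := exists_sum_tmul (comul (R := k) (1 : H))
  simp only [piL_eq_sum hab (x * _), ← mul_assoc, counit_mul_piL]

theorem piL_coe (z : leftBase k H) : piL k (z : H) = z := by
  obtain ⟨z, g, rfl⟩ := z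
  simpa using piL_mul_piL (k := k) 1 g

/-- The product z Π^L(h) lies in the subalgebra R, and Π^L is the identity there. -/
theorem piL_base_mul (z : leftBase k H) (h : H) : piL k (z * h) = z * piL k h := by
  have hz : piL k h ∈ leftBase k H := Set.mem_range_self h
  rw [← piL_mul_piL]
  exact piL_coe ⟨z * piL k h, (leftBase k H).mul_mem z.2 hz⟩

/-- Compare the two formulas for (Δ ⊗ H)Δ(1) after applying ε(– g) to the first leg, where z =
Π^L(g). -/
theorem sum_mul_base (hab : comul (R := k) (1 : H) = ∑ i, a i ⊗ₜ b i) (z : leftBase k H) :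
    ∑ i, (a i * z) ⊗ₜ[k] b i = ∑ i, (z * a i) ⊗ₜ[k] b i := by
  obtain ⟨z, g, rfl⟩ := z
  have h := congrArg ((TensorProduct.lid k (H ⊗[k] H)).toLinearMap ∘ₗ
      (counit (R := k) ∘ₗ LinearMap.mulRight k g).rTensor (H ⊗[k] H))
    ((comul_comul_one_sum' hab).symm.trans (comul_comul_one_sum hab))
  simp only [map_sum, LinearMap.comp_apply, LinearMap.rTensor_tmul, LinearEquiv.coe_coe,
    TensorProduct.lid_tmul, LinearMap.mulRight_apply] at h
  rw [Finset.sum_comm] at h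
  conv at h => rhs; rw [Finset.sum_comm]
  simp only [piL_eq_sum hab, Finset.mul_sum, Finset.sum_mul, TensorProduct.sum_tmul]
  simpa [TensorProduct.smul_tmul'] using h

/-- In Sweedler notation 1₍₁₎ h ⊗ 1₍₂₎ = h₍₁₎ ⊗ Π^L(h₍₂₎). The map G multiplies the first leg by
h₍₁₎ and contracts the middle leg with ε(– h₍₂₎). On Δ(1₍₁₎) ⊗ 1₍₂₎ it gives the left side by
multiplicativity of Δ; on the expanded form it gives the right side because Δ(1)Δ(h) = Δ(h). -/
theorem sum_mul_tmul (hab : comul (R := k) (1 : H) = ∑ i, a i ⊗ₜ b i) {m : ℕ} {c d : Fin m → H}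
    {h : H} (hcd : comul (R := k) h = ∑ l, c l ⊗ₜ d l) :
    ∑ i, (a i * h) ⊗ₜ[k] b i = ∑ l, c l ⊗ₜ[k] piL k (d l) := by
  let G : H ⊗[k] (H ⊗[k] H) →ₗ[k] H ⊗[k] H := ∑ l, TensorProduct.map (LinearMap.mulRight k (c l))
    ((TensorProduct.lid k H).toLinearMap ∘ₗ
      (counit (R := k) ∘ₗ LinearMap.mulRight k (d l)).rTensor H)
  have hG : ∀ (u : H ⊗[k] H) (v : H), G (TensorProduct.assoc k H H H (u ⊗ₜ v)) =
      TensorProduct.rid k H (counit.lTensor H (u * comul h)) ⊗ₜ v := by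
    intro u v
    rw [hcd]
    induction u using TensorProduct.induction_on with
    | zero => simp
    | add x y hx hy => simp only [map_add, TensorProduct.add_tmul, add_mul, hx, hy]
    | tmul x y => simp [G, TensorProduct.smul_tmul, Finset.mul_sum, TensorProduct.sum_tmul]
  have h1 := congrArg G (comul_comul_one_sum' hab)
  simp only [map_sum, hG, ← WeakBialgebra.comul_mul, lTensor_counit_comul,
    TensorProduct.rid_tmul, one_smul] at h1
  rw [h1]
  have h2 : comul (R := k) (1 : H) * comul h = comul h := by rw [← WeakBialgebra.comul_mul, one_mul]
  rw [hab, hcd] at h2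
  have h3 := fun j => congrArg (TensorProduct.map (LinearMap.id : H →ₗ[k] H)
      (LinearMap.toSpanSingleton k H (b j) ∘ₗ counit (R := k) ∘ₗ LinearMap.mulLeft k (a j))) h2
  simp only [Finset.sum_mul_sum, map_sum, Algebra.TensorProduct.tmul_mul_tmul,
    TensorProduct.map_tmul, LinearMap.id_apply, LinearMap.comp_apply, LinearMap.mulLeft_apply,
    LinearMap.toSpanSingleton_apply] at h3
  simp only [piL_eq_sum hab, TensorProduct.tmul_sum]
  conv_rhs => rw [Finset.sum_comm]
  simp only [← h3, G, LinearMap.sum_apply, TensorProduct.map_tmul, LinearMap.comp_apply,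
    LinearMap.rTensor_tmul, LinearEquiv.coe_coe, TensorProduct.lid_tmul, LinearMap.mulRight_apply,
    mul_assoc]
  rw [Finset.sum_comm]

end Rep

end Base

/-! ### The target map and the Casimir element of the base -/

section Target

open Coalgebra

variable (k : Type*) {H : Type*} [CommRing k] [Ring H] [Algebra k H]
variable [WeakBialgebra k H]

/-- `h ↦ 1₍₁₎ ε(1₍₂₎ h)`, the inverse of the antipode on `Im Π^L`. -/
def tgtLin : H →ₗ[k] H where
  toFun h := TensorProduct.rid k H
    ((counit (R := k) ∘ₗ LinearMap.mulRight k h).lTensor H (comul (R := k) (1 : H)))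
  map_add' g h := by
    obtain ⟨n, a, b, hab⟩ := exists_sum_tmul (comul (R := k) (1 : H))
    simp [hab, mul_add, add_smul, Finset.sum_add_distrib]
  map_smul' c h := by
    obtain ⟨n, a, b, hab⟩ := exists_sum_tmul (comul (R := k) (1 : H))
    simp [hab, mul_smul, Finset.smul_sum]

/-- `Π^L` as a map to its image. -/
def piLin : H →ₗ[k] leftBase k H where
  toFun h := ⟨piL k h, Set.mem_range_self h⟩
  map_add' g h := by
    obtain ⟨n, a, b, hab⟩ := exists_sum_tmul (comul (R := k) (1 : H))
    apply Subtype.ext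
    simp [piL_eq_sum hab, mul_add, add_smul, Finset.sum_add_distrib]
  map_smul' c h := by
    obtain ⟨n, a, b, hab⟩ := exists_sum_tmul (comul (R := k) (1 : H))
    apply Subtype.ext
    simp [piL_eq_sum hab, mul_smul, Finset.smul_sum]

variable {k}

@[simp] theorem coe_piLin (h : H) : (piLin k h : H) = piL k h := rfl

theorem piLin_coe (z : leftBase k H) : piLin k (z : H) = z := Subtype.ext (piL_coe z)

theorem tgtLin_eq_sum {n : ℕ} {a b : Fin n → H}
    (hab : comul (R := k) (1 : H) = ∑ i, a i ⊗ₜ b i) (g : H) :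
    tgtLin k g = ∑ i, counit (R := k) (b i * g) • a i := by
  simp [tgtLin, hab]

theorem counit_piL (g : H) : counit (R := k) (piL k g) = counit (R := k) g := by
  simpa using counit_mul_piL (k := k) 1 g

/-- The other counit axiom, ε(x y z) = ε(x y₍₁₎) ε(y₍₂₎ z), at y = 1. Thus t(g), Π^L(g) and g are
indistinguishable as right factors under ε. -/
theorem counit_mul_tgtLin (x g : H) :
    counit (R := k) (x * tgtLin k g) = counit (R := k) (x * g) := by
  obtain ⟨n, a, b, hab⟩ := exists_sum_tmul (comul (R := k) (1 : H))
  rw [counit_mul_sum hab x g, tgtLin_eq_sum hab]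
  simp [Finset.mul_sum, mul_comm]

theorem piL_mul_tgtLin (x g : H) : piL k (x * tgtLin k g) = piL k (x * g) := by
  obtain ⟨n, a, b, hab⟩ := exists_sum_tmul (comul (R := k) (1 : H))
  simp only [piL_eq_sum hab (x * _), ← mul_assoc, counit_mul_tgtLin]

theorem piL_tgtLin (g : H) : piL k (tgtLin k g) = piL k g := by
  simpa using piL_mul_tgtLin (k := k) 1 g

theorem tgtLin_piL (g : H) : tgtLin k (piL k g) = tgtLin k g := by
  obtain ⟨n, a, b, hab⟩ := exists_sum_tmul (comul (R := k) (1 : H))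
  simp only [tgtLin_eq_sum hab, counit_mul_piL]

theorem tgtLin_one : tgtLin k (1 : H) = 1 := by
  obtain ⟨n, a, b, hab⟩ := exists_sum_tmul (comul (R := k) (1 : H))
  simpa [tgtLin_eq_sum hab] using sum_smul_counit hab

theorem piL_one : piL k (1 : H) = 1 := by
  obtain ⟨n, a, b, hab⟩ := exists_sum_tmul (comul (R := k) (1 : H))
  simpa [piL_eq_sum hab] using sum_counit_smul hab

/-- In `sum_mul_base` the element z commutes with the first leg of Δ(1); contracting the second leg
with ε(– g) turns that leg into t(g). -/
theorem base_mul_tgtLin (z : leftBase k H) (g : H) : z * tgtLin k g = tgtLin k g * z := by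
  obtain ⟨n, a, b, hab⟩ := exists_sum_tmul (comul (R := k) (1 : H))
  have h := congrArg (TensorProduct.rid k H ∘
    ((counit (R := k) ∘ₗ LinearMap.mulRight k g).lTensor H)) (sum_mul_base hab z)
  simp only [Function.comp_apply, map_sum, LinearMap.lTensor_tmul, TensorProduct.rid_tmul,
    LinearMap.comp_apply, LinearMap.mulRight_apply] at h
  simp only [tgtLin_eq_sum hab, Finset.mul_sum, Finset.sum_mul, mul_smul_comm, smul_mul_assoc]
  exact h.symm

/-- Contract the last leg of (Δ ⊗ H)Δ(1) with ε(– g): one side becomes Δ(t(g)), the other keeps t(g)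
in the second leg. -/
theorem comul_tgtLin {n : ℕ} {a b : Fin n → H}
    (hab : comul (R := k) (1 : H) = ∑ i, a i ⊗ₜ b i) (g : H) :
    comul (R := k) (tgtLin k g) = ∑ i, a i ⊗ₜ (b i * tgtLin k g) := by
  have hl : ∀ (u : H ⊗[k] H) (v : H),
      ((TensorProduct.rid k H).toLinearMap ∘ₗ
        (counit (R := k) ∘ₗ LinearMap.mulRight k g).lTensor H).lTensor H
        (TensorProduct.assoc k H H H (u ⊗ₜ v)) = counit (R := k) (v * g) • u := by
    intro u v
    induction u using TensorProduct.induction_on with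
    | zero => simp
    | add x y hx hy => simp only [map_add, TensorProduct.add_tmul, smul_add, hx, hy]
    | tmul x y => simp
  have h := congrArg (((TensorProduct.rid k H).toLinearMap ∘ₗ
    (counit (R := k) ∘ₗ LinearMap.mulRight k g).lTensor H).lTensor H) (comul_comul_one_sum hab)
  simp only [map_sum, hl] at h
  rw [tgtLin_eq_sum hab]
  simp only [map_sum, map_smul, h]
  simp [Finset.mul_sum, TensorProduct.tmul_sum]

theorem exists_sum_tmul_base : ∃ (n : ℕ) (a : Fin n → H) (b : Fin n → leftBase k H),
    comul (R := k) (1 : H) = ∑ i, a i ⊗ₜ (b i : H) := by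
  obtain ⟨n, a, b, hab⟩ := exists_sum_tmul (comul (R := k) (1 : H))
  exact ⟨n, a, fun i => piLin k (b i), sum_tmul_piL hab⟩

/-- The source of the Casimir property. Take h = t(g) in `sum_mul_tmul`: the second leg becomes
Π^L(1₍₂₎ t(g)) = 1₍₂₎ Π^L(g), which needs a presentation of Δ(1) with second legs in R. The identity
is therefore transported to such a presentation. -/
theorem sum_mul_tgtLin {n : ℕ} {a b : Fin n → H}
    (hab : comul (R := k) (1 : H) = ∑ i, a i ⊗ₜ b i) (g : H) :
    ∑ i, (a i * tgtLin k g) ⊗ₜ[k] b i = ∑ i, a i ⊗ₜ[k] (b i * piL k g) := by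
  obtain ⟨m, a', b', hab'⟩ := exists_sum_tmul_base (k := k) (H := H)
  have h1 : ∑ i, (a i * tgtLin k g) ⊗ₜ[k] b i = ∑ i, (a' i * tgtLin k g) ⊗ₜ[k] (b' i : H) := by
    have h := congrArg (TensorProduct.map (LinearMap.mulRight k (tgtLin k g)) LinearMap.id)
      (hab.symm.trans hab')
    simpa using h
  have h2 : ∑ i, a i ⊗ₜ[k] (b i * piL k g) = ∑ i, a' i ⊗ₜ[k] ((b' i : H) * piL k g) := by
    have h := congrArg (TensorProduct.map LinearMap.id (LinearMap.mulRight k (piL k g)))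
      (hab.symm.trans hab')
    simpa using h
  rw [h1, h2, sum_mul_tmul hab' (comul_tgtLin hab' g)]
  simp only [piL_base_mul, piL_tgtLin]

/-- Contracting the second leg of `sum_mul_tgtLin` with ε(– s) shows that t is an antihomomorphism
on R. -/
theorem tgtLin_mul (r s : leftBase k H) :
    tgtLin k (r * s : H) = tgtLin k (s : H) * tgtLin k (r : H) := by
  obtain ⟨n, a, b, hab⟩ := exists_sum_tmul (comul (R := k) (1 : H))
  have h := congrArg (TensorProduct.rid k H ∘
    ((counit (R := k) ∘ₗ LinearMap.mulRight k (s : H)).lTensor H)) (sum_mul_tgtLin hab (r : H))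
  simp only [Function.comp_apply, map_sum, LinearMap.lTensor_tmul, TensorProduct.rid_tmul,
    LinearMap.comp_apply, LinearMap.mulRight_apply, piL_coe] at h
  simp only [tgtLin_eq_sum hab (s : H), tgtLin_eq_sum hab (r * s : H), Finset.sum_mul,
    smul_mul_assoc, ← mul_assoc]
  exact h.symm

variable (k H) in
/-- The inclusion `R ⊆ H` and the map `r ↦ 1₍₁₎ ε(1₍₂₎ r)` as source and target. -/
def baseEnv : EnvRing k (leftBase k H) H where
  src := (leftBase k H).val
  tgt := AlgHom.ofLinearMap (tgtLin k ∘ₗ (leftBase k H).val.toLinearMap ∘ₗ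
      (MulOpposite.opLinearEquiv k).symm.toLinearMap) (by simpa using tgtLin_one) (by
      rintro ⟨r⟩ ⟨s⟩
      exact tgtLin_mul s r)
  src_tgt_comm := by
    rintro a ⟨b⟩
    exact base_mul_tgtLin a b

@[simp] theorem baseEnv_tgt (r : leftBase k H) : (baseEnv k H).tgt (.op r) = tgtLin k (r : H) := rfl

theorem exists_casimirSystem : ∃ φ : CasimirSystem k (leftBase k H),
    (∀ r, φ.form r = counit (R := k) (r : H)) ∧
      comul (R := k) (1 : H) = ∑ i, tgtLin k (φ.x i : H) ⊗ₜ (φ.y i : H) := by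
  obtain ⟨n, a, b, hab⟩ := exists_sum_tmul_base (k := k) (H := H)
  have hab' : comul (R := k) (1 : H) = ∑ i, tgtLin k (a i) ⊗ₜ (b i : H) := by
    have h := sum_counit_mul hab
    rw [Finset.sum_comm] at h
    rw [hab, ← h]
    simp only [tgtLin_eq_sum hab, TensorProduct.sum_tmul, TensorProduct.smul_tmul']
  have ht : ∀ h, tgtLin k (piLin k h : H) = tgtLin k h := tgtLin_piL
  -- Since t ∘ Π^L = t, replacing the first legs aᵢ by xᵢ = Π^L(aᵢ) in R preserves Δ(1) = ∑ t(aᵢ) ⊗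
  -- bᵢ.
  refine ⟨⟨n, fun i => piLin k (a i), b, counit ∘ₗ (leftBase k H).val.toLinearMap, ?_, ?_, ?_, ?_⟩,
    fun _ => rfl, ?_⟩
  -- Casimir identity: apply Π^L ⊗ Π^L to `sum_mul_tgtLin`, using t(aᵢ) t(r) = t(r xᵢ) and Π^L ∘ t =
  -- Π^L.
  · intro r
    have h := congrArg (TensorProduct.map (piLin k) (piLin k)) (sum_mul_tgtLin hab' (r : H))
    simp only [map_sum, TensorProduct.map_tmul, piL_coe] at h
    have h1 : ∀ i, piLin k (tgtLin k (a i) * tgtLin k (r : H)) = r * piLin k (a i) := fun i => by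
      apply Subtype.ext
      rw [← ht, ← tgtLin_mul, coe_piLin, piL_tgtLin, piL_base_mul, coe_piLin]
      congr 1
      exact piL_coe (piLin k (a i))
    have h2 : ∀ i, piLin k (b i * r : H) = b i * r := fun i => piLin_coe (b i * r)
    have h3 : ∀ i, piLin k (tgtLin k (a i)) = piLin k (a i) := fun i => Subtype.ext (piL_tgtLin _)
    simpa only [h1, h2, h3, piLin_coe] using h
  -- Separability: apply ε to the first leg of Δ(1)Δ(1) = Δ(1). The factor ∑ ε(aᵢ aⱼ) bᵢ is Π^L(aⱼ)
  -- = xⱼ.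
  · apply Subtype.ext
    have h : comul (R := k) (1 : H) * comul (1 : H) = comul (1 : H) := by
      rw [← WeakBialgebra.comul_mul, one_mul]
    have h := congrArg (fun w => TensorProduct.lid k H (counit.rTensor H w)) h
    rw [hab, Finset.sum_mul_sum] at h
    simp only [map_sum, LinearMap.rTensor_tmul, Algebra.TensorProduct.tmul_mul_tmul,
      TensorProduct.lid_tmul, sum_counit_smul hab] at h
    rw [Finset.sum_comm] at h
    simpa [piL_eq_sum hab, Finset.sum_mul] using h
  · apply Subtype.ext
    have h := sum_counit_smul hab
    simpa [counit_piL] using h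
  · have h1 : piLin k (1 : H) = 1 := Subtype.ext piL_one
    simpa [h1] using congrArg (piLin k) (sum_smul_counit hab)
  · simpa only [ht] using hab'

variable (k H) in
/-- The separable Frobenius structure of `R = Im Π^L`. -/
def baseCasimir : CasimirSystem k (leftBase k H) := (exists_casimirSystem (k := k) (H := H)).choose

theorem baseCasimir_form (r : leftBase k H) :
    (baseCasimir k H).form r = counit (R := k) (r : H) :=
  (exists_casimirSystem (k := k) (H := H)).choose_spec.1 r

theorem comul_one_eq : comul (R := k) (1 : H) =
    ∑ i, tgtLin k ((baseCasimir k H).x i : H) ⊗ₜ ((baseCasimir k H).y i : H) :=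
  (exists_casimirSystem (k := k) (H := H)).choose_spec.2

/-- Membership in R gives Δ(r) = Δ(1)(r ⊗ 1), and r commutes with the first leg of Δ(1). This form
makes coproducts left R-linear. -/
theorem comul_base (r : leftBase k H) :
    comul (R := k) (r : H) = ((r : H) ⊗ₜ[k] (1 : H)) * comul (1 : H) := by
  rw [(mem_range_piL k (r : H)).1 r.2, comul_one_eq, Finset.sum_mul, Finset.mul_sum]
  have h := sum_mul_base (comul_one_eq (k := k) (H := H)) r
  simpa using h

theorem comul_tgtLin' (r : leftBase k H) :
    comul (R := k) (tgtLin k (r : H)) = ((1 : H) ⊗ₜ[k] tgtLin k (r : H)) * comul (1 : H) := by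
  rw [comul_tgtLin comul_one_eq]
  conv_rhs => rw [comul_one_eq]
  simp [Finset.mul_sum, base_mul_tgtLin]

end Target

section Antipode

open Coalgebra

variable {k H : Type*} [CommRing k] [Ring H] [Algebra k H] [WeakHopfAlgebra k H]

/-- For h = t(r) the coproduct is 1₍₁₎ ⊗ 1₍₂₎ t(r), so S(h) = S(h₍₁₎) Π^L(h₍₂₎) becomes S(1₍₁₎) 1₍₂₎
r = Π^R(1) r = r. -/
theorem antipode_tgtLin (r : leftBase k H) :
    WeakHopfAlgebra.antipode (k := k) (tgtLin k (r : H)) = r := by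
  obtain ⟨n, a, b, hab⟩ := exists_sum_tmul_base (k := k) (H := H)
  have h := WeakHopfAlgebra.antipode_mul_antipode (k := k) (tgtLin k (r : H))
  have h1 := WeakHopfAlgebra.antipode_mul (k := k) (1 : H)
  rw [hab] at h1
  rw [comul_tgtLin hab] at h
  simp only [map_sum, LinearMap.lTensor_tmul, TensorProduct.map_tmul, LinearMap.comp_apply,
    WeakHopfAlgebra.mul_antipode, LinearMap.mul'_apply, piL_base_mul, piL_tgtLin, piL_coe,
    LinearMap.id_apply] at h h1
  simp only [← mul_assoc, ← Finset.sum_mul, h1] at h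
  rw [← h, piR_eq_sum hab]
  simp only [one_mul]
  rw [sum_smul_counit hab, one_mul]

end Antipode

/-! ## Comparison of the structures -/

section Unit

open Coalgebra

variable {k H : Type*} [CommRing k] [Ring H] [Algebra k H]
variable {A : Type*} [Ring A] [Algebra k A]
variable {C : Type*} [AddCommGroup C] [Module k C] [Module H C] [IsScalarTower k H C]
variable {M : Type*} [AddCommGroup M] [Module k M] [Module A M] [IsScalarTower k A M]

theorem tensorAct_mul (u v : H ⊗[k] A) (w : C ⊗[k] M) :
    tensorAct k H A C M (u * v) w = tensorAct k H A C M u (tensorAct k H A C M v w) := by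
  induction u using TensorProduct.induction_on with
  | zero => simp
  | add x y hx hy => simp only [map_add, add_mul, LinearMap.add_apply, hx, hy]
  | tmul h a =>
    induction v using TensorProduct.induction_on with
    | zero => simp
    | add x y hx hy => simp only [map_add, mul_add, LinearMap.add_apply, hx, hy]
    | tmul h' a' =>
      induction w using TensorProduct.induction_on with
      | zero => simp
      | add x y hx hy => simp only [map_add, hx, hy]
      | tmul c m => simp [mul_smul]

theorem tensorAct_self (u v : H ⊗[k] A) : tensorAct k H A H A u v = u * v := by
  induction u using TensorProduct.induction_on with
  | zero => simp
  | add x y hx hy => simp only [map_add, add_mul, LinearMap.add_apply, hx, hy]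
  | tmul h a =>
    induction v using TensorProduct.induction_on with
    | zero => simp
    | add x y hx hy => simp only [map_add, mul_add, hx, hy]
    | tmul h' a' => simp

theorem tensorAct_tmul_one (h : H) (w : C ⊗[k] M) :
    tensorAct k H A C M (h ⊗ₜ 1) w = (Algebra.lsmul k k C h).rTensor M w := by
  induction w using TensorProduct.induction_on with
  | zero => simp
  | add x y hx hy => simp only [map_add, hx, hy]
  | tmul c m => simp

theorem tensorAct_one_tmul (a : A) (w : C ⊗[k] M) :
    tensorAct k H A C M (1 ⊗ₜ a) w = (Algebra.lsmul k k M a).lTensor C w := by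
  induction w using TensorProduct.induction_on with
  | zero => simp
  | add x y hx hy => simp only [map_add, hx, hy]
  | tmul c m => simp

variable [WeakBialgebra k H]

/-- The element `1₍₁₎ ⊗ s(1₍₂₎)` of `H ⊗ A`. -/
def baseUnit (s : leftBase k H →ₐ[k] A) : H ⊗[k] A :=
  ∑ i, tgtLin k ((baseCasimir k H).x i : H) ⊗ₜ s ((baseCasimir k H).y i)

theorem baseUnit_src : baseUnit (baseEnv k H).src = comul (R := k) (1 : H) := comul_one_eq.symm

/-- This links the two settings: invariance under the splitting idempotent becomes a statement about
multiplication by one element, which is Δ(1) or ρ(1) in the cases of interest. -/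
theorem proj_eq_tensorAct (s : leftBase k H →ₐ[k] A) (w : C ⊗[k] M) :
    (baseCasimir k H).proj ((baseEnv k H).bimod C).r (leftAct s M) w =
      tensorAct k H A C M (baseUnit s) w := by
  induction w using TensorProduct.induction_on with
  | zero => simp
  | add x y hx hy => simp only [map_add, hx, hy]
  | tmul c m => simp [baseUnit]

theorem base_mul_baseUnit (s : leftBase k H →ₐ[k] A) (r : leftBase k H) :
    ((r : H) ⊗ₜ[k] (1 : A)) * baseUnit s = baseUnit s * ((r : H) ⊗ₜ[k] (1 : A)) := by
  simp [baseUnit, Finset.mul_sum, Finset.sum_mul, base_mul_tgtLin]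

theorem baseUnit_mul_tgtLin (s : leftBase k H →ₐ[k] A) (r : leftBase k H) :
    baseUnit s * (tgtLin k (r : H) ⊗ₜ[k] (1 : A)) = baseUnit s * ((1 : H) ⊗ₜ[k] s r) := by
  have h := (baseCasimir k H).casimir_apply (((TensorProduct.mk k H A).compl₂ s.toLinearMap).comp
    (tgtLin k ∘ₗ (leftBase k H).val.toLinearMap)) r
  simpa [baseUnit, Finset.sum_mul, tgtLin_mul] using h

/-- The Takeuchi condition holds for `baseUnit s` by the Casimir identity, hence for all its left
multiples. The values Δ(h) and ρ(a) are such multiples since Δ(h)Δ(1) = Δ(h) and ρ(a)ρ(1) = ρ(a). -/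
theorem can_mem_takeuchi (s : leftBase k H →ₐ[k] A) (w : H ⊗[k] A) (hw : w * baseUnit s = w) :
    can _ _ w ∈ takeuchi (baseEnv k H) s := by
  intro r
  have h1 : ∀ w : H ⊗[k] A, TensorProduct.map (LinearMap.mulRight k (tgtLin k (r : H)))
      LinearMap.id w = w * (tgtLin k (r : H) ⊗ₜ[k] (1 : A)) := by
    intro w
    induction w using TensorProduct.induction_on with
    | zero => simp
    | add x y hx hy => simp only [map_add, add_mul, hx, hy]
    | tmul h a => simp
  have h2 : ∀ w : H ⊗[k] A, TensorProduct.map LinearMap.id (LinearMap.mulRight k (s r)) w =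
      w * ((1 : H) ⊗ₜ[k] s r) := by
    intro w
    induction w using TensorProduct.induction_on with
    | zero => simp
    | add x y hx hy => simp only [map_add, add_mul, hx, hy]
    | tmul h a => simp
  refine congrArg (can _ _) (?_ : TensorProduct.map (LinearMap.mulRight k (tgtLin k (r : H)))
    LinearMap.id w = TensorProduct.map LinearMap.id (LinearMap.mulRight k (s r)) w)
  rw [h1, h2, ← hw, mul_assoc, mul_assoc, baseUnit_mul_tgtLin]

theorem can_baseUnit (s : leftBase k H →ₐ[k] A) :
    can ((baseEnv k H).bimod H).r (leftAct s A) (baseUnit s) = can _ _ (1 ⊗ₜ 1) := by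
  rw [← (baseCasimir k H).can_proj _ _ (1 ⊗ₜ 1), proj_eq_tensorAct, tensorAct_self,
    ← Algebra.TensorProduct.one_def, mul_one]

end Unit

/-! ### Module coalgebras and the bialgebroid of a weak bialgebra -/

section ModuleCoalgebra

open Coalgebra

variable {k H : Type*} [CommRing k] [Ring H] [Algebra k H] [WeakBialgebra k H]
variable {C : Type*} [AddCommGroup C] [Module k C] [Module H C] [IsScalarTower k H C]

namespace WeakModuleCoalgebra

variable (w : WeakModuleCoalgebra k H C)

theorem proj_comul (c : C) :
    (baseCasimir k H).proj ((baseEnv k H).bimod C).r ((baseEnv k H).bimod C).l (w.coalg.comul c) =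
      w.coalg.comul c := by
  rw [proj_eq_tensorAct, baseUnit_src, ← w.comul_smul, one_smul]

theorem comul_base_smul (r : leftBase k H) (c : C) :
    w.coalg.comul ((r : H) • c) = (Algebra.lsmul k k C (r : H)).rTensor C (w.coalg.comul c) := by
  rw [w.comul_smul, comul_base, tensorAct_mul, ← w.comul_smul, one_smul, tensorAct_tmul_one]

theorem comul_tgtLin_smul (r : leftBase k H) (c : C) :
    w.coalg.comul (tgtLin k (r : H) • c) =
      (Algebra.lsmul k k C (tgtLin k (r : H))).lTensor C (w.coalg.comul c) := by
  rw [w.comul_smul, comul_tgtLin', tensorAct_mul, ← w.comul_smul, one_smul, tensorAct_one_tmul]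

/-- The counit `c ↦ ε(1₍₁₎ · c) 1₍₂₎` with values in `R`. -/
def baseCounit : C →ₗ[k] leftBase k H :=
  (baseCasimir k H).liftForm ((baseEnv k H).bimod C).r w.coalg.counit

theorem coe_baseCounit (c : C) : (w.baseCounit c : H) =
    ∑ i, w.coalg.counit (tgtLin k ((baseCasimir k H).x i : H) • c) •
      ((baseCasimir k H).y i : H) := by
  simp [baseCounit, CasimirSystem.liftForm_apply]

/-- The weak counit axiom at g = 1, with the sum over Δ(1) collected into the R-valued counit. -/
theorem counit_smul_eq (h : H) (c : C) :
    w.coalg.counit (h • c) = counit (R := k) (h * w.baseCounit c) := by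
  have h1 := w.counit_smul h 1 c
  rw [mul_one] at h1
  rw [h1, comul_one_eq, coe_baseCounit]
  simp [Finset.mul_sum]

theorem baseCounit_smul (h : H) (c : C) : w.baseCounit (h • c) = piLin k (h * w.baseCounit c) := by
  apply Subtype.ext
  rw [coe_baseCounit, coe_piLin, piL_eq_sum comul_one_eq]
  simp only [smul_smul, w.counit_smul_eq, mul_assoc]

/-- The `R`-coring structure on a weak module coalgebra. -/
def toCoring : Coring ((baseEnv k H).bimod C) :=
  (baseCasimir k H).coringOfCoalgebra _ w.coalg w.proj_comul w.comul_base_smul w.comul_tgtLin_smul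
    (by
      intro r c
      have h := w.baseCounit_smul (r : H) c
      rwa [show (r : H) * w.baseCounit c = ((r * w.baseCounit c : leftBase k H) : H) from rfl,
        piLin_coe] at h)

@[simp] theorem toCoring_counit (c : C) : w.toCoring.counit c = w.baseCounit c := rfl

end WeakModuleCoalgebra

variable (k H) in
/-- The weak module coalgebra `H`. -/
def selfModuleCoalgebra : WeakModuleCoalgebra k H H where
  coalg := inferInstance
  comul_smul g h := by rw [smul_eq_mul, WeakBialgebra.comul_mul, tensorAct_self]
  counit_smul h g c := WeakBialgebra.counit_mul_mul' h g c

theorem selfModuleCoalgebra_baseCounit (h : H) :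
    (selfModuleCoalgebra k H).baseCounit h = piLin k h := by
  apply Subtype.ext
  rw [WeakModuleCoalgebra.coe_baseCounit, coe_piLin, piL_eq_sum comul_one_eq]
  rfl

theorem comul_mul_baseUnit (h : H) :
    comul (R := k) h * baseUnit (baseEnv k H).src = comul (R := k) h := by
  rw [baseUnit_src, ← WeakBialgebra.comul_mul, mul_one]

variable (k H) in
/-- The bialgebroid over `Im Π^L` attached to a weak bialgebra. -/
@[reducible] def baseBialgebroid : Bialgebroid k (leftBase k H) H where
  toEnvRing := baseEnv k H
  coring := (selfModuleCoalgebra k H).toCoring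
  comul_mem h := can_mem_takeuchi _ _ (comul_mul_baseUnit h)
  comul_one := by
    refine Eq.trans ?_ (can_baseUnit (k := k) (H := H) (baseEnv k H).src)
    rw [baseUnit_src]; rfl
  comul_mul g h := by
    refine congrArg (can _ _) ?_
    rw [tensorAct_self]
    exact WeakBialgebra.comul_mul g h
  counit_one := by
    rw [WeakModuleCoalgebra.toCoring_counit, selfModuleCoalgebra_baseCounit]
    exact Subtype.ext piL_one
  counit_mul_src g h := by
    simp only [WeakModuleCoalgebra.toCoring_counit, selfModuleCoalgebra_baseCounit]
    exact Subtype.ext (piL_mul_piL g h).symm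
  counit_mul_tgt g h := by
    simp only [WeakModuleCoalgebra.toCoring_counit, selfModuleCoalgebra_baseCounit]
    apply Subtype.ext
    rw [baseEnv_tgt, coe_piLin, coe_piLin, piL_mul_tgtLin, coe_piLin, piL_mul_piL]

theorem baseBialgebroid_counit (h : H) : (baseBialgebroid k H).coring.counit h = piLin k h :=
  selfModuleCoalgebra_baseCounit h

/-- Weak module coalgebras are module coalgebras over the bialgebroid. -/
def WeakModuleCoalgebra.toModuleCoalgebra (w : WeakModuleCoalgebra k H C) :
    ModuleCoalgebra (baseBialgebroid k H) C where
  coring := w.toCoring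
  comul_smul h c := congrArg (can _ _) (w.comul_smul h c)
  counit_smul h c := by
    rw [baseBialgebroid_counit]
    exact w.baseCounit_smul h c

namespace ModuleCoalgebra

variable (c : ModuleCoalgebra (baseBialgebroid k H) C)

/-- The `k`-linear coproduct underlying a module coalgebra over the bialgebroid. -/
def baseComul : C →ₗ[k] C ⊗[k] C := (baseCasimir k H).sect _ _ ∘ₗ c.coring.comul

theorem can_baseComul (x : C) : can _ _ (c.baseComul x) = c.coring.comul x :=
  (baseCasimir k H).can_sect _ _ _

/-- The right side represents the correct class over R, and it is unchanged by the idempotent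
because Δ(1)Δ(h) = Δ(h). -/
theorem baseComul_smul (h : H) (x : C) :
    c.baseComul (h • x) = tensorAct k H H C C (comul (R := k) h) (c.baseComul x) := by
  have h1 : c.coring.comul (h • x) =
      can _ _ (tensorAct k H H C C (comul (R := k) h) (c.baseComul x)) := by
    rw [c.comul_smul, ← c.can_baseComul x]
    rfl
  rw [baseComul, LinearMap.comp_apply, h1, CasimirSystem.sect_can, proj_eq_tensorAct,
    baseUnit_src, ← tensorAct_mul, ← WeakBialgebra.comul_mul, one_mul]
  rfl

theorem form_counit_smul (h : H) (x : C) : (baseCasimir k H).form (c.coring.counit (h • x)) =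
    counit (R := k) (h * c.coring.counit x) := by
  rw [c.counit_smul, baseBialgebroid_counit, baseCasimir_form, coe_piLin, counit_piL]
  rfl

/-- Module coalgebras over the bialgebroid are weak module coalgebras. -/
def toWeak : WeakModuleCoalgebra k H C where
  coalg := (baseCasimir k H).coalgebraOfCoring c.coring
  comul_smul := c.baseComul_smul
  counit_smul h g x := by
    change (baseCasimir k H).form (c.coring.counit ((h * g) • x)) = _
    -- With e the R-valued counit, the weak counit axiom for C reduces to that of H with e(x) as the
    -- third factor.
    rw [form_counit_smul, WeakBialgebra.counit_mul_mul']
    congr 3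
    ext y
    exact (c.form_counit_smul y x).symm

end ModuleCoalgebra

theorem Coring.eq_of {R : Type*} [Ring R] [Algebra k R] {C : Type*} [AddCommGroup C] [Module k C]
    {b : Bimod k R C} {D D' : Coring b} (h₁ : D.comul = D'.comul) (h₂ : D.counit = D'.counit) :
    D = D' := by
  cases D; cases D'
  cases h₁; cases h₂
  rfl

theorem ModuleCoalgebra.eq_of {c c' : ModuleCoalgebra (baseBialgebroid k H) C}
    (h : c.coring = c'.coring) : c = c' := by
  cases c; cases c'
  cases h
  rfl

theorem WeakModuleCoalgebra.eq_of {w w' : WeakModuleCoalgebra k H C}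
    (h₁ : w.coalg.comul = w'.coalg.comul) (h₂ : w.coalg.counit = w'.coalg.counit) : w = w' := by
  obtain ⟨@⟨⟨δ, ε⟩, _, _, _⟩, _, _⟩ := w
  obtain ⟨@⟨⟨δ', ε'⟩, _, _, _⟩, _, _⟩ := w'
  obtain rfl : δ = δ' := h₁
  obtain rfl : ε = ε' := h₂
  rfl

theorem ModuleCoalgebra.toWeak_toModuleCoalgebra (c : ModuleCoalgebra (baseBialgebroid k H) C) :
    c.toWeak.toModuleCoalgebra = c := by
  refine eq_of <| Coring.eq_of (LinearMap.ext fun x => c.can_baseComul x)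
    (LinearMap.ext fun x => ?_)
  exact (baseCasimir k H).liftForm_form _ _ c.coring.counit_right x

theorem WeakModuleCoalgebra.toModuleCoalgebra_toWeak (w : WeakModuleCoalgebra k H C) :
    w.toModuleCoalgebra.toWeak = w := by
  refine eq_of (LinearMap.ext fun x => w.proj_comul x) (LinearMap.ext fun x => ?_)
  exact (baseCasimir k H).form_liftForm _ _ x

theorem WeakModuleCoalgebra.toModuleCoalgebra_isInduced (w : WeakModuleCoalgebra k H C) :
    w.toModuleCoalgebra.IsInduced w where
  comul_eq _ := rfl
  counit_eq x := by
    refine (w.coe_baseCounit x).trans ?_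
    rw [comul_one_eq]
    simp

end ModuleCoalgebra

/-! ### Comodule algebras -/

section ComoduleAlgebra

open Coalgebra

variable {k H : Type*} [CommRing k] [Ring H] [Algebra k H] [WeakBialgebra k H]
variable {A : Type*} [Ring A] [Algebra k A]
variable {C : Type*} [AddCommGroup C] [Module k C] [Module H C] [IsScalarTower k H C]
variable {M : Type*} [AddCommGroup M] [Module k M] [Module A M] [IsScalarTower k A M]

namespace WeakComoduleAlgebra

variable (w : WeakComoduleAlgebra k H A)

/-- `h ↦ ε(1₍₋₁₎ h) 1₍₀₎`. -/
def srcLin : H →ₗ[k] A where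
  toFun h := TensorProduct.lid k A
    ((counit (R := k) ∘ₗ LinearMap.mulRight k h).rTensor A (w.coact 1))
  map_add' g h := by
    obtain ⟨n, a, b, hab⟩ := exists_sum_tmul (w.coact 1)
    simp [hab, mul_add, add_smul, Finset.sum_add_distrib]
  map_smul' c h := by
    obtain ⟨n, a, b, hab⟩ := exists_sum_tmul (w.coact 1)
    simp [hab, mul_smul, Finset.smul_sum]

theorem srcLin_eq_sum {n : ℕ} {a : Fin n → H} {b : Fin n → A}
    (hab : w.coact 1 = ∑ i, a i ⊗ₜ b i) (h : H) :
    w.srcLin h = ∑ i, counit (R := k) (a i * h) • b i := by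
  simp [srcLin, hab]

theorem srcLin_piL (h : H) : w.srcLin (piL k h) = w.srcLin h := by
  obtain ⟨n, a, b, hab⟩ := exists_sum_tmul (w.coact 1)
  simp only [w.srcLin_eq_sum hab, counit_mul_piL]

theorem srcLin_one : w.srcLin 1 = 1 := by
  obtain ⟨n, a, b, hab⟩ := exists_sum_tmul (w.coact 1)
  have h := w.counit_coact 1
  rw [hab] at h
  rw [w.srcLin_eq_sum hab]
  simpa using h

theorem coact_injective : Function.Injective w.coact :=
  Function.LeftInverse.injective
    (g := fun x => TensorProduct.lid k A (counit.rTensor A x)) w.counit_coact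

theorem coact_one_sum {n : ℕ} {a : Fin n → H} {b : Fin n → A}
    (hab : w.coact 1 = ∑ i, a i ⊗ₜ b i) :
    ∑ i, a i ⊗ₜ[k] w.coact (b i) = ∑ j, ∑ i, tgtLin k ((baseCasimir k H).x i : H) ⊗ₜ[k]
      ((a j * ((baseCasimir k H).y i : H)) ⊗ₜ[k] b j) := by
  have h := w.coact_one
  rw [hab, comul_one_eq] at h
  simp only [map_sum, TensorProduct.sum_tmul, TensorProduct.tmul_sum, Finset.sum_mul_sum,
    LinearMap.lTensor_tmul, TensorProduct.assoc_tmul,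
    Algebra.TensorProduct.tmul_mul_tmul, one_mul, mul_one] at h
  exact h

/-- Apply the counit to the middle leg of the axiom for (H ⊗ ρ)ρ(1); the contraction ε(1₍₋₁₎ yᵢ)
1₍₀₎ is the source map at yᵢ. -/
theorem coact_one_eq : w.coact 1 = ∑ i, tgtLin k ((baseCasimir k H).x i : H) ⊗ₜ[k]
    w.srcLin ((baseCasimir k H).y i : H) := by
  obtain ⟨n, a, b, hab⟩ := exists_sum_tmul (w.coact 1)
  have h := congrArg (((TensorProduct.lid k A).toLinearMap ∘ₗ counit.rTensor A).lTensor H)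
    (w.coact_one_sum hab)
  simp only [map_sum, LinearMap.lTensor_tmul, LinearMap.comp_apply, LinearMap.rTensor_tmul,
    LinearEquiv.coe_coe, TensorProduct.lid_tmul, w.counit_coact] at h
  rw [hab, h, Finset.sum_comm]
  simp only [w.srcLin_eq_sum hab, TensorProduct.tmul_sum]

/-- Contract the first leg of the same axiom with ε(– r). On the other side ∑ ε(t(xᵢ) r) yᵢ = Π^L(r)
= r. -/
theorem coact_srcLin (r : leftBase k H) :
    w.coact (w.srcLin r) = w.coact 1 * ((r : H) ⊗ₜ[k] (1 : A)) := by
  obtain ⟨n, a, b, hab⟩ := exists_sum_tmul (w.coact 1)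
  have h := congrArg ((TensorProduct.lid k (H ⊗[k] A)).toLinearMap ∘ₗ
    (counit ∘ₗ LinearMap.mulRight k (r : H)).rTensor (H ⊗[k] A)) (w.coact_one_sum hab)
  simp only [map_sum, LinearMap.comp_apply, LinearMap.rTensor_tmul, LinearMap.mulRight_apply,
    LinearEquiv.coe_coe, TensorProduct.lid_tmul] at h
  rw [w.srcLin_eq_sum hab, map_sum]
  simp only [map_smul, h]
  have hr := piL_eq_sum (comul_one_eq (k := k) (H := H)) (r : H)
  rw [piL_coe] at hr
  conv_rhs => rw [hr, hab]
  simp [Finset.sum_mul, Finset.mul_sum, TensorProduct.sum_tmul, TensorProduct.smul_tmul']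
  exact Finset.sum_comm

/-- The source map of the comodule algebra over the bialgebroid. -/
def src : leftBase k H →ₐ[k] A :=
  AlgHom.ofLinearMap (w.srcLin ∘ₗ (leftBase k H).val.toLinearMap) w.srcLin_one (by
    intro r s
    -- The counit makes ρ injective, so multiplicativity is checked after ρ: ρ(s(r)) ρ(1) (s' ⊗ 1) =
    -- ρ(s(r)) (s' ⊗ 1) = ρ(1) (r s' ⊗ 1), where s' is the second argument.
    apply w.coact_injective
    have h : w.coact (w.srcLin r) = w.coact (w.srcLin r) * w.coact 1 := by
      rw [← w.coact_mul, mul_one]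
    have hs := w.coact_srcLin (r * s)
    rw [w.coact_mul]
    simp only [LinearMap.comp_apply, AlgHom.toLinearMap_apply, Subalgebra.coe_val]
    rw [hs, w.coact_srcLin s, ← mul_assoc, ← h, w.coact_srcLin, mul_assoc]
    simp)

theorem src_apply (r : leftBase k H) : w.src r = w.srcLin r := rfl

theorem coact_one_eq_baseUnit : w.coact 1 = baseUnit w.src := w.coact_one_eq

theorem coact_src (r : leftBase k H) :
    w.coact (w.src r) = ((r : H) ⊗ₜ[k] (1 : A)) * w.coact 1 := by
  rw [src_apply, coact_srcLin, coact_one_eq_baseUnit, base_mul_baseUnit]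

/-- The idempotent acts as ρ(1), and compatibility with 1 · m = m gives invariance. Stating it for a
general compatible ρ covers both A itself and Doi-Koppinen modules. -/
theorem proj_coact (ρ : M →ₗ[k] C ⊗[k] M)
    (hρ : ∀ (x : A) (m : M), ρ (x • m) = tensorAct k H A C M (w.coact x) (ρ m)) (m : M) :
    (baseCasimir k H).proj ((baseEnv k H).bimod C).r (leftAct w.src M) (ρ m) = ρ m := by
  rw [proj_eq_tensorAct, ← coact_one_eq_baseUnit, ← hρ, one_smul]

theorem coact_src_smul (ρ : M →ₗ[k] C ⊗[k] M)
    (hρ : ∀ (x : A) (m : M), ρ (x • m) = tensorAct k H A C M (w.coact x) (ρ m))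
    (r : leftBase k H) (m : M) :
    ρ (leftAct w.src M r m) = (((baseEnv k H).bimod C).l r).rTensor M (ρ m) := by
  change ρ (w.src r • m) = _
  rw [hρ, coact_src, tensorAct_mul, ← hρ, one_smul, tensorAct_tmul_one]
  rfl

theorem coact_smul_self (x y : A) :
    w.coact (x • y) = tensorAct k H A H A (w.coact x) (w.coact y) := by
  rw [tensorAct_self, smul_eq_mul, w.coact_mul]

theorem coact_mul_baseUnit (x : A) : w.coact x * baseUnit w.src = w.coact x := by
  rw [← coact_one_eq_baseUnit, ← w.coact_mul, mul_one]

/-- Weak comodule algebras are comodule algebras over the bialgebroid. -/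
def toComoduleAlgebra : ComoduleAlgebra (baseBialgebroid k H) A where
  src := w.src
  comod := (baseCasimir k H).comoduleOfCoact _ _ comul counit (fun _ => rfl)
    (fun h => by rw [baseBialgebroid_counit, baseCasimir_form, coe_piLin, counit_piL])
    w.coact (w.proj_coact _ w.coact_smul_self) (w.coact_src_smul _ w.coact_smul_self)
    w.coassoc w.counit_coact
  coact_mem a := can_mem_takeuchi _ _ (w.coact_mul_baseUnit a)
  coact_one := by
    refine Eq.trans ?_ (can_baseUnit (k := k) (H := H) w.src)
    rw [← coact_one_eq_baseUnit]
    rfl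
  coact_mul a b := congrArg (can _ _) (w.coact_smul_self a b)

theorem toComoduleAlgebra_isInduced : w.toComoduleAlgebra.IsInduced w where
  src_eq h := w.srcLin_piL h
  coact_eq _ := rfl

end WeakComoduleAlgebra

namespace ComoduleAlgebra

variable (a : ComoduleAlgebra (baseBialgebroid k H) A)

/-- The `k`-linear coaction underlying a comodule algebra over the bialgebroid. -/
def baseCoact : A →ₗ[k] H ⊗[k] A := (baseCasimir k H).liftCoact a.comod

theorem can_baseCoact (x : A) : can _ _ (a.baseCoact x) = a.comod.coact x :=
  (baseCasimir k H).can_liftCoact _ _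

theorem baseCoact_one : a.baseCoact 1 = baseUnit a.src := by
  rw [baseCoact, CasimirSystem.liftCoact, LinearMap.comp_apply, a.coact_one,
    CasimirSystem.sect_can, proj_eq_tensorAct, tensorAct_self, ← Algebra.TensorProduct.one_def,
    mul_one]

theorem baseUnit_act_liftCoact {D : Coring ((baseEnv k H).bimod C)}
    (m : LeftComodule D (leftAct a.src M)) (x : M) :
    tensorAct k H A C M (baseUnit a.src) ((baseCasimir k H).liftCoact m x) =
      (baseCasimir k H).liftCoact m x := by
  rw [← proj_eq_tensorAct, CasimirSystem.proj_liftCoact]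

/-- Both sides represent the same class over R. The right side is fixed by the idempotent since
`baseUnit a.src` is a left unit for the lifted coaction of A. -/
theorem liftCoact_smul {D : Coring ((baseEnv k H).bimod C)}
    (m : LeftComodule D (leftAct a.src M)) (hm : ∀ (x : A) (y : M), m.coact (x • y) =
      takAct (baseEnv k H) a.src ⟨a.comod.coact x, a.coact_mem x⟩ (m.coact y)) (x : A) (y : M) :
    (baseCasimir k H).liftCoact m (x • y) =
      tensorAct k H A C M (a.baseCoact x) ((baseCasimir k H).liftCoact m y) := by
  have h1 : m.coact (x • y) = can _ _
      (tensorAct k H A C M (a.baseCoact x) ((baseCasimir k H).liftCoact m y)) := by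
    rw [hm, ← CasimirSystem.can_liftCoact (baseCasimir k H) m y]
    have h2 : (⟨a.comod.coact x, a.coact_mem x⟩ : takeuchi (baseEnv k H) a.src) =
      ⟨can _ _ (a.baseCoact x), by rw [can_baseCoact]; exact a.coact_mem x⟩ :=
      Subtype.ext (a.can_baseCoact x).symm
    rw [h2]
    rfl
  have h3 := a.baseUnit_act_liftCoact a.comod x
  rw [tensorAct_self] at h3
  rw [CasimirSystem.liftCoact, LinearMap.comp_apply, h1, CasimirSystem.sect_can,
    proj_eq_tensorAct, ← tensorAct_mul]
  congr 2

theorem baseCoact_mul (x y : A) : a.baseCoact (x * y) = a.baseCoact x * a.baseCoact y := by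
  rw [← tensorAct_self]
  exact a.liftCoact_smul a.comod a.coact_mul x y

theorem baseCoact_src (r : leftBase k H) :
    a.baseCoact (a.src r) = ((r : H) ⊗ₜ[k] (1 : A)) * baseUnit a.src := by
  have h := (baseCasimir k H).liftCoact_left a.comod r 1
  change a.baseCoact (a.src r • 1) = (Algebra.lsmul k k H (r : H)).rTensor A (a.baseCoact 1) at h
  rw [smul_eq_mul, mul_one, baseCoact_one] at h
  rw [h, ← tensorAct_self, tensorAct_tmul_one]

theorem sect_comul (h : H) : (baseCasimir k H).sect _ _ ((baseBialgebroid k H).coring.comul h) =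
    comul (R := k) h :=
  (selfModuleCoalgebra k H).proj_comul h

theorem form_counit (h : H) : (baseCasimir k H).form ((baseBialgebroid k H).coring.counit h) =
    counit (R := k) h := by
  rw [baseBialgebroid_counit, baseCasimir_form, coe_piLin, counit_piL]

/-- Comodule algebras over the bialgebroid are weak comodule algebras. -/
def toWeak : WeakComoduleAlgebra k H A where
  coact := a.baseCoact
  coassoc := (baseCasimir k H).liftCoact_coassoc a.comod comul sect_comul
  counit_coact := (baseCasimir k H).liftCoact_counit a.comod counit form_counit
  coact_mul := a.baseCoact_mul
  coact_one := by
    -- Here ρ(1) = ∑ t(xᵢ) ⊗ s(yᵢ) and ρ(s(yᵢ)) = (yᵢ ⊗ 1)ρ(1); commuting yᵢ past t(xⱼ) puts the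
    -- factors in the order the axiom asks for.
    rw [baseCoact_one, comul_one_eq]
    simp only [baseUnit, map_sum, LinearMap.lTensor_tmul, baseCoact_src]
    simp only [TensorProduct.sum_tmul, TensorProduct.tmul_sum, Finset.mul_sum, Finset.sum_mul,
      map_sum, TensorProduct.assoc_tmul, Algebra.TensorProduct.tmul_mul_tmul, one_mul, mul_one,
      base_mul_tgtLin]

/-- The recovered source is ∑ ε(t(xᵢ) r) s(yᵢ) = s(Π^L(r)), and Π^L fixes r. -/
theorem toWeak_src (r : leftBase k H) : a.toWeak.src r = a.src r := by
  rw [WeakComoduleAlgebra.src_apply, a.toWeak.srcLin_eq_sum a.baseCoact_one]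
  have h := congrArg a.src (Subtype.ext ((piL_eq_sum (comul_one_eq (k := k) (H := H)) (r : H)).trans
    (by simp)) : piLin k (r : H) = ∑ i, counit (R := k)
      (tgtLin k ((baseCasimir k H).x i : H) * r) • (baseCasimir k H).y i)
  rw [piLin_coe] at h
  simpa using h.symm

/-- The two coactions take values in quotients depending on the source maps, so they are compared
through a common representative in H ⊗ A. -/
theorem eq_of {a a' : ComoduleAlgebra (baseBialgebroid k H) A} (h₁ : a.src = a'.src)
    (h₂ : ∀ x, ∃ w : H ⊗[k] A, a.comod.coact x = can _ _ w ∧ a'.comod.coact x = can _ _ w) :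
    a = a' := by
  obtain ⟨s, ⟨c, _, _, _⟩, _, _, _⟩ := a
  obtain ⟨s', ⟨c', _, _, _⟩, _, _, _⟩ := a'
  obtain rfl : s = s' := h₁
  obtain rfl : c = c' := LinearMap.ext fun x => by
    obtain ⟨w, hw, hw'⟩ := h₂ x
    exact hw.trans hw'.symm
  rfl

theorem toWeak_toComoduleAlgebra : a.toWeak.toComoduleAlgebra = a :=
  eq_of (AlgHom.ext a.toWeak_src) fun x => ⟨a.baseCoact x, rfl, (a.can_baseCoact x).symm⟩

end ComoduleAlgebra

theorem WeakComoduleAlgebra.toComoduleAlgebra_toWeak (w : WeakComoduleAlgebra k H A) :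
    w.toComoduleAlgebra.toWeak = w := by
  have h : w.toComoduleAlgebra.toWeak.coact = w.coact :=
    LinearMap.ext (w.proj_coact _ w.coact_smul_self)
  generalize w.toComoduleAlgebra.toWeak = w' at h
  cases w; cases w'
  cases h
  rfl

end ComoduleAlgebra

/-! ### Doi-Koppinen modules -/

section Modules

open Coalgebra

variable {k H : Type*} [CommRing k] [Ring H] [Algebra k H] [WeakBialgebra k H]
variable {A : Type*} [Ring A] [Algebra k A]
variable {C : Type*} [AddCommGroup C] [Module k C] [Module H C] [IsScalarTower k H C]
variable {M : Type*} [AddCommGroup M] [Module k M] [Module A M] [IsScalarTower k A M]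
variable {a : WeakComoduleAlgebra k H A} {c : WeakModuleCoalgebra k H C}

/-- Weak Doi-Koppinen modules are Doi-Koppinen modules over `R`. -/
def WeakDKModule.toDKModule (w : WeakDKModule a c M) :
    DKModule a.toComoduleAlgebra c.toModuleCoalgebra M where
  comod := (baseCasimir k H).comoduleOfCoact _ _ c.coalg.comul c.coalg.counit (fun _ => rfl)
    ((baseCasimir k H).form_liftForm _ _) w.coact (a.proj_coact _ w.coact_smul)
    (a.coact_src_smul _ w.coact_smul) w.coassoc w.counit_coact
  coact_smul x m := congrArg (can _ _) (w.coact_smul x m)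

/-- Doi-Koppinen modules over `R` are weak Doi-Koppinen modules. -/
def DKModule.toWeak (m : DKModule a.toComoduleAlgebra c.toModuleCoalgebra M) :
    WeakDKModule a c M where
  coact := (baseCasimir k H).liftCoact m.comod
  coassoc := (baseCasimir k H).liftCoact_coassoc m.comod c.coalg.comul c.proj_comul
  counit_coact := (baseCasimir k H).liftCoact_counit m.comod c.coalg.counit
    ((baseCasimir k H).form_liftForm _ _)
  coact_smul x y := by
    -- Lifting the induced coaction of A returns the original one, because its values are invariant
    -- under the idempotent.
    have h : a.toComoduleAlgebra.baseCoact = a.coact :=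
      LinearMap.ext (a.proj_coact _ a.coact_smul_self)
    rw [← h]
    exact a.toComoduleAlgebra.liftCoact_smul m.comod m.coact_smul x y

theorem DKModule.toWeak_toDKModule (m : DKModule a.toComoduleAlgebra c.toModuleCoalgebra M) :
    m.toWeak.toDKModule = m := by
  have h : m.toWeak.toDKModule.comod.coact = m.comod.coact :=
    LinearMap.ext ((baseCasimir k H).can_liftCoact m.comod)
  generalize m.toWeak.toDKModule = m' at h
  obtain ⟨⟨ρ, _, _, _⟩, _⟩ := m
  obtain ⟨⟨ρ', _, _, _⟩, _⟩ := m'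
  obtain rfl : ρ' = ρ := h
  rfl

theorem WeakDKModule.toDKModule_toWeak (w : WeakDKModule a c M) : w.toDKModule.toWeak = w := by
  have h : w.toDKModule.toWeak.coact = w.coact := LinearMap.ext (a.proj_coact _ w.coact_smul)
  generalize w.toDKModule.toWeak = w' at h
  cases w; cases w'
  cases h
  rfl

end Modules

/-! ## The isomorphisms of categories -/

section Categories

open Coalgebra

/-- Agreement on morphisms involves transport along the object equalities, and a faithful functor
lets it be checked after forgetting. The forgetful composites used here agree definitionally, so
only the objects need work. -/
theorem functor_eq_of_faithful {𝒞 𝒟 ℰ : Type*} [Category 𝒞] [Category 𝒟] [Category ℰ]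
    {F G : 𝒞 ⥤ 𝒟} (U : 𝒟 ⥤ ℰ) [U.Faithful] (hobj : ∀ X, F.obj X = G.obj X)
    (h : F ⋙ U = G ⋙ U) : F = G :=
  CategoryTheory.Functor.ext hobj fun X Y f => U.map_injective <| by
    rw [Functor.map_comp, Functor.map_comp, eqToHom_map, eqToHom_map]
    exact Functor.congr_hom h f

variable {k : Type uk} [CommRing k] {H : Type uH} [Ring H] [Algebra k H] [WeakBialgebra k H]

section ComoduleAlgebraCat

/-- The source map is read off from ρ(1), and a colinear algebra map carries ρ(1) to ρ(1). So being
a map of R-rings is automatic. -/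
theorem WeakComoduleAlgebraCat.Hom.map_src {X Y : WeakComoduleAlgebraCat.{uk, uH, uA} k H}
    (f : X ⟶ Y) (r : leftBase k H) : f.hom (X.str.src r) = Y.str.src r := by
  obtain ⟨n, a, b, hab⟩ := exists_sum_tmul (X.str.coact 1)
  have h := f.colinear 1
  rw [map_one, hab] at h
  simp only [map_sum, LinearMap.lTensor_tmul] at h
  rw [WeakComoduleAlgebra.src_apply, WeakComoduleAlgebra.src_apply, X.str.srcLin_eq_sum hab,
    Y.str.srcLin_eq_sum h]
  simp

variable (k H) in
/-- The functor from weak comodule algebras to comodule algebras over the bialgebroid. -/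
def toComoduleAlgebraCat : WeakComoduleAlgebraCat.{uk, uH, uA} k H ⥤
    ComoduleAlgebraCat.{uk, uH, uH, uA} (baseBialgebroid k H) where
  obj X := ⟨X.carrier, X.str.toComoduleAlgebra⟩
  map f := ⟨f.hom, f.map_src, fun x => congrArg (can _ _) (f.colinear x)⟩

variable (k H) in
/-- The functor from comodule algebras over the bialgebroid to weak comodule algebras. -/
def ofComoduleAlgebraCat : ComoduleAlgebraCat.{uk, uH, uH, uA} (baseBialgebroid k H) ⥤
    WeakComoduleAlgebraCat.{uk, uH, uA} k H where
  obj X := ⟨X.carrier, X.str.toWeak⟩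
  map {X Y} f := ⟨f.hom, fun x => by
    exact (congrArg ((baseCasimir k H).sect _ _) (f.colinear x)).trans
      ((baseCasimir k H).sect_balMap _ _ _ _ _)⟩

/-- The underlying algebra. -/
def weakComoduleAlgebraForget : WeakComoduleAlgebraCat.{uk, uH, uA} k H ⥤ AlgCat.{uA} k where
  obj X := AlgCat.of k X.carrier
  map f := AlgCat.ofHom f.hom

instance : (weakComoduleAlgebraForget (k := k) (H := H)).Faithful where
  map_injective h := WeakComoduleAlgebraCat.Hom.ext (congrArg AlgCat.Hom.hom h)

/-- The underlying algebra. -/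
def comoduleAlgebraForget :
    ComoduleAlgebraCat.{uk, uH, uH, uA} (baseBialgebroid k H) ⥤ AlgCat.{uA} k where
  obj X := AlgCat.of k X.carrier
  map f := AlgCat.ofHom f.hom

instance : (comoduleAlgebraForget (k := k) (H := H)).Faithful where
  map_injective h := ComoduleAlgebraCat.Hom.ext (congrArg AlgCat.Hom.hom h)

theorem toComoduleAlgebraCat_comp_of :
    toComoduleAlgebraCat.{uk, uH, uA} k H ⋙ ofComoduleAlgebraCat k H = 𝟭 _ :=
  functor_eq_of_faithful weakComoduleAlgebraForget
    (fun X => congrArg (WeakComoduleAlgebraCat.mk X.carrier) X.str.toComoduleAlgebra_toWeak) rfl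

theorem ofComoduleAlgebraCat_comp_to :
    ofComoduleAlgebraCat.{uk, uH, uA} k H ⋙ toComoduleAlgebraCat k H = 𝟭 _ :=
  functor_eq_of_faithful comoduleAlgebraForget
    (fun X => congrArg (ComoduleAlgebraCat.mk X.carrier) X.str.toWeak_toComoduleAlgebra) rfl

end ComoduleAlgebraCat

section ModuleCoalgebraCat

theorem WeakModuleCoalgebraCat.Hom.map_baseCounit
    {X Y : WeakModuleCoalgebraCat.{uk, uH, uC} k H} (f : X ⟶ Y) (x : X.carrier) :
    Y.str.baseCounit (f.hom x) = X.str.baseCounit x := by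
  apply Subtype.ext
  simp only [WeakModuleCoalgebra.coe_baseCounit, ← map_smul, f.map_counit]

variable (k H) in
/-- The functor from weak module coalgebras to module coalgebras over the bialgebroid. -/
def toModuleCoalgebraCat : WeakModuleCoalgebraCat.{uk, uH, uC} k H ⥤
    ModuleCoalgebraCat.{uk, uH, uH, uC} (baseBialgebroid k H) where
  obj X := ⟨X.carrier, X.str.toModuleCoalgebra⟩
  map f := ⟨f.hom, fun x => congrArg (can _ _) (f.map_comul x), f.map_baseCounit⟩

variable (k H) in
/-- The functor from module coalgebras over the bialgebroid to weak module coalgebras. -/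
def ofModuleCoalgebraCat : ModuleCoalgebraCat.{uk, uH, uH, uC} (baseBialgebroid k H) ⥤
    WeakModuleCoalgebraCat.{uk, uH, uC} k H where
  obj X := ⟨X.carrier, X.str.toWeak⟩
  map {X Y} f := ⟨f.hom, fun x => by
    exact (congrArg ((baseCasimir k H).sect _ _) (f.map_comul x)).trans
      ((baseCasimir k H).sect_balMap _ _ _ _ _),
    fun x => congrArg (baseCasimir k H).form (f.map_counit x)⟩

/-- The underlying `H`-module. -/
def weakModuleCoalgebraForget : WeakModuleCoalgebraCat.{uk, uH, uC} k H ⥤ ModuleCat.{uC} H where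
  obj X := ModuleCat.of H X.carrier
  map f := ModuleCat.ofHom f.hom

instance : (weakModuleCoalgebraForget (k := k) (H := H)).Faithful where
  map_injective h := WeakModuleCoalgebraCat.Hom.ext (congrArg ModuleCat.Hom.hom h)

/-- The underlying `H`-module. -/
def moduleCoalgebraForget :
    ModuleCoalgebraCat.{uk, uH, uH, uC} (baseBialgebroid k H) ⥤ ModuleCat.{uC} H where
  obj X := ModuleCat.of H X.carrier
  map f := ModuleCat.ofHom f.hom

instance : (moduleCoalgebraForget (k := k) (H := H)).Faithful where
  map_injective h := ModuleCoalgebraCat.Hom.ext (congrArg ModuleCat.Hom.hom h)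

theorem toModuleCoalgebraCat_comp_of :
    toModuleCoalgebraCat.{uk, uH, uC} k H ⋙ ofModuleCoalgebraCat k H = 𝟭 _ :=
  functor_eq_of_faithful weakModuleCoalgebraForget
    (fun X => by
      change WeakModuleCoalgebraCat.mk X.carrier X.str.toModuleCoalgebra.toWeak =
        WeakModuleCoalgebraCat.mk X.carrier X.str
      rw [WeakModuleCoalgebra.toModuleCoalgebra_toWeak]) rfl

theorem ofModuleCoalgebraCat_comp_to :
    ofModuleCoalgebraCat.{uk, uH, uC} k H ⋙ toModuleCoalgebraCat k H = 𝟭 _ :=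
  functor_eq_of_faithful moduleCoalgebraForget
    (fun X => by
      change ModuleCoalgebraCat.mk X.carrier X.str.toWeak.toModuleCoalgebra =
        ModuleCoalgebraCat.mk X.carrier X.str
      rw [ModuleCoalgebra.toWeak_toModuleCoalgebra]) rfl

end ModuleCoalgebraCat

theorem isCatIso_prod {𝒞 𝒟 𝒞' 𝒟' : Type*} [Category 𝒞] [Category 𝒟] [Category 𝒞'] [Category 𝒟']
    {F : 𝒞 ⥤ 𝒟} {G : 𝒟 ⥤ 𝒞} {F' : 𝒞' ⥤ 𝒟'} {G' : 𝒟' ⥤ 𝒞'} (h₁ : F ⋙ G = 𝟭 _)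
    (h₂ : G ⋙ F = 𝟭 _) (h₁' : F' ⋙ G' = 𝟭 _) (h₂' : G' ⋙ F' = 𝟭 _) : IsCatIso (F.prod F') := by
  refine ⟨G.prod G', ?_, ?_⟩
  · change (F ⋙ G).prod (F' ⋙ G') = _
    rw [h₁, h₁']
    rfl
  · change (G ⋙ F).prod (G' ⋙ F') = _
    rw [h₂, h₂']
    rfl

section Modules

variable (D : WeakDKDatum.{uk, uH, uA, uC} k H)

/-- The Doi-Koppinen datum over `R` attached to a weak Doi-Koppinen datum. -/
abbrev toDKDatum : DKDatum.{uk, uH, uH, uA, uC} (baseBialgebroid k H) :=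
  (⟨D.1.carrier, D.1.str.toComoduleAlgebra⟩, ⟨D.2.carrier, D.2.str.toModuleCoalgebra⟩)

/-- The functor from weak Doi-Koppinen modules to Doi-Koppinen modules over `R`. -/
def toDKModuleCat : WeakDKModuleCat.{uk, uH, uA, uC, uM} D ⥤
    DKModuleCat.{uk, uH, uH, uA, uC, uM} (toDKDatum D) where
  obj M := ⟨M.carrier, M.str.toDKModule⟩
  map f := ⟨f.hom, fun x => congrArg (can _ _) (f.colinear x)⟩

instance moduleOfDKModuleCat (M : DKModuleCat.{uk, uH, uH, uA, uC, uM} (toDKDatum D)) :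
    Module D.1.carrier M.carrier := M.modA

instance isScalarTowerOfDKModuleCat
    (M : DKModuleCat.{uk, uH, uH, uA, uC, uM} (toDKDatum D)) :
    IsScalarTower k D.1.carrier M.carrier := M.tower

/-- The functor from Doi-Koppinen modules over `R` to weak Doi-Koppinen modules. -/
def ofDKModuleCat : DKModuleCat.{uk, uH, uH, uA, uC, uM} (toDKDatum D) ⥤
    WeakDKModuleCat.{uk, uH, uA, uC, uM} D where
  obj M := ⟨M.carrier, M.str.toWeak⟩
  map {X Y} f := ⟨f.hom, fun x => by
    exact (congrArg ((baseCasimir k H).sect _ _) (f.colinear x)).trans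
      ((baseCasimir k H).sect_balMap _ _ _ _ _)⟩

instance : (weakModuleForget D).Faithful where
  map_injective h := WeakDKModuleCat.Hom.ext (congrArg ModuleCat.Hom.hom h)

instance : (moduleForget (toDKDatum D)).Faithful where
  map_injective h := DKModuleCat.Hom.ext (congrArg ModuleCat.Hom.hom h)

theorem isCatIso_toDKModuleCat : IsCatIso (toDKModuleCat.{uk, uH, uA, uC, uM} D) :=
  ⟨ofDKModuleCat D,
    functor_eq_of_faithful (weakModuleForget D)
      (fun X => by
        change WeakDKModuleCat.mk X.carrier X.str.toDKModule.toWeak =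
          WeakDKModuleCat.mk X.carrier X.str
        rw [WeakDKModule.toDKModule_toWeak]) rfl,
    functor_eq_of_faithful (moduleForget (toDKDatum D))
      (fun X => by
        change DKModuleCat.mk (D := toDKDatum D) X.carrier
          (WeakDKModule.toDKModule (DKModule.toWeak (a := D.1.str) (c := D.2.str) X.str)) =
          DKModuleCat.mk (D := toDKDatum D) X.carrier X.str
        rw [DKModule.toWeak_toDKModule]) rfl⟩

end Modules

end Categories

theorem baseBialgebroid_isAssociated {k H : Type*} [CommRing k] [Ring H] [Algebra k H]
    [WeakHopfAlgebra k H]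
    (hS : Function.Bijective (WeakHopfAlgebra.antipode (k := k) (H := H))) :
    IsAssociated hS (baseBialgebroid k H) where
  src_eq _ := rfl
  tgt_eq r := by
    rw [LinearEquiv.eq_symm_apply]
    exact antipode_tgtLin r
  comul_eq _ := rfl
  counit_eq h := by rw [baseBialgebroid_counit, coe_piLin]

end

end DoiKoppinen

universe uk uH uA uC uM

theorem theorem3p8 {k : Type uk} [CommRing k] {H : Type uH} [Ring H] [Algebra k H]
    [WeakHopfAlgebra k H]
    (hS : Function.Bijective (WeakHopfAlgebra.antipode (k := k) (H := H))) :
    ∃ B : Bialgebroid k (leftBase k H) H, IsAssociated hS B ∧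
      ∃ F : WeakDKDatum.{uk, uH, uA, uC} k H ⥤ DKDatum.{uk, uH, uH, uA, uC} B,
        IsCatIso F ∧ F ⋙ forgetDK B = weakForget k H ∧
        ∀ D : WeakDKDatum.{uk, uH, uA, uC} k H,
          ∃ (a : ComoduleAlgebra B D.1.carrier) (c : ModuleCoalgebra B D.2.carrier),
            F.obj D = (⟨D.1.carrier, a⟩, ⟨D.2.carrier, c⟩) ∧
            a.IsInduced D.1.str ∧ c.IsInduced D.2.str ∧
            ∃ Φ : WeakDKModuleCat.{uk, uH, uA, uC, uM} D ⥤
                DKModuleCat.{uk, uH, uH, uA, uC, uM} (B := B)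
                  (⟨D.1.carrier, a⟩, ⟨D.2.carrier, c⟩),
              IsCatIso Φ ∧ Φ ⋙ moduleForget _ = weakModuleForget D ∧
              ∀ M : WeakDKModuleCat.{uk, uH, uA, uC, uM} D, ∃ m : DKModule a c M.carrier,
                Φ.obj M = ⟨M.carrier, m⟩ ∧
                ∀ x, m.comod.coact x = can _ _ (M.str.coact x) := by
  refine ⟨baseBialgebroid k H, baseBialgebroid_isAssociated hS,
    (toComoduleAlgebraCat k H).prod (toModuleCoalgebraCat k H),
    isCatIso_prod toComoduleAlgebraCat_comp_of ofComoduleAlgebraCat_comp_to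
      toModuleCoalgebraCat_comp_of ofModuleCoalgebraCat_comp_to, rfl, fun D => ?_⟩
  exact ⟨D.1.str.toComoduleAlgebra, D.2.str.toModuleCoalgebra, rfl,
    D.1.str.toComoduleAlgebra_isInduced, D.2.str.toModuleCoalgebra_isInduced,
    toDKModuleCat D, isCatIso_toDKModuleCat D, rfl, fun M => ⟨M.str.toDKModule, rfl, fun _ => rfl⟩⟩
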